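/- For an integer $n\ge 1$, let $\mathcal{M}_n$ denote the set of all perfect matchings of the complete graph $K_{2n}$, so $|\mathcal{M}_n|=(2n-1)!!$ (with $(-1)!!=1$). For an edge $e$ of $K_{2n}$, the star centered at $e$ is $\mathcal{S}_e=\{M\in\mathcal{M}_n : e\in M\}$. For $S\subseteq\mathcal{M}_n$ let $\mathbf{1}_S:\mathcal{M}_n\to\mathbb{R}$ be its indicator function, and for $f:\mathcal{M}_n\to\mathbb{R}$ put $$\|f\|=\Big(\frac{1}{|\mathcal{M}_n|}\sum_{M\in\mathcal{M}_n} f(M)^2\Big)^{1/2}.$$ Let $U$ be the linear span of $\{\mathbf{1}_{\mathcal{S}_e} : e\in E(K_{2n})\}$, and let $\operatorname{Proj}_U$ be the orthogonal projection onto $U$. Let $\mathrm{round}(c)$ be the integer closest to $c$, rounding up in case of a tie, and let $\Delta$ denote symmetric difference. There exist absolute constants $C_0>0$ and $\varepsilon_0>0$ such that the following holds for all integers $n\ge 1$ and all real $\varepsilon$ with $0\le\varepsilon\le\varepsilon_0$. Let $A\subseteq\mathcal{M}_n$ be a set of size $|A|=c\,(2n-3)!!$, where $c\le\frac{2n-1}{2}$.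 If $$\|\mathbf{1}_A-\operatorname{Proj}_U(\mathbf{1}_A)\|^2\le \varepsilon\,\frac{c}{2n-1},$$ then there is a set $B$ that is a union of $\mathrm{round}(c)$ stars (centered at $\mathrm{round}(c)$ distinct edges of $K_{2n}$) such that $$|A\,\Delta\,B|\le C_0\,c^2\,(2n-3)!!\left(\sqrt{\varepsilon}+\frac{1}{2n-1}\right).$$ Moreover, $$|c-\mathrm{round}(c)|\le C_0\,c^2\left(\sqrt{\varepsilon}+\frac{1}{2n-1}\right).$$ -/

import Mathlib

/-!
Write `N = 2n - 1`, let `w = (2n - 3)‼` be the size of a star, `f` the indicator function of `A`,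
`p e` the fraction of the star centered at `e` that lies in `A`, and `x e = p e - c / N`. Every
vertex is matched exactly once, so `∑ b, x s(a, b) = 0` for each vertex `a`, and second moments show
that the projection of `f` is `c / N + (N - 2) / (N - 1) * Y`, where `Y π = ∑ e ∈ π, x e`. Hence `f`
is close to `Y` in mean square, and `∑ e, x e ^ 2` is close to `c`.

Two estimates of the third moment of the positive part `Y⁺` force the densities to be near `0` or
`1`. As `Y` is close to `1` on `A` on average, `∑ π, Y⁺ π ^ 3` is at least about `w * c`. On the
other hand, switching two edges of a random matching gives an exchangeable pair for which `Y`
satisfies an exact linear regression, and Stein's method bounds `∑ π, Y⁺ π ^ 3` by about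
`∑ π, Y⁺ π * ∑ e ∈ π, x e ^ 2`, which is about `w * ∑ e, x e ^ 2 * p e` because `Y⁺` is close to
`f`. So `∑ e, x e ^ 2 * (1 - p e)` is small, about `c` edges have `p e ≥ 1 / 2`, and `A` contains
almost all of each of their stars. Two stars share at most `w / (N - 2)` matchings, so the union of
these stars is close to `A`; adding or removing a few stars makes their number `round c`.

If `c / N` is bounded below, in particular if `n` is bounded and `A` is nonempty, the error bounds
exceed `3 * c`, and any `round c` stars will do.
-/

open scoped Nat symmDiff

/-- The perfect matchings of the complete graph `K_{2n}`, that is, the vertices of the perfect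
matching graph. -/
abbrev PerfMatching (n : ℕ) : Type :=
  {M : (⊤ : SimpleGraph (Fin (2 * n))).Subgraph // M.IsPerfectMatching}

/-- The edges of the complete graph `K_{2n}`. -/
abbrev KEdge (n : ℕ) : Type := ↥((⊤ : SimpleGraph (Fin (2 * n))).edgeSet)

noncomputable instance instFintypePerfMatching (n : ℕ) : Fintype (PerfMatching n) :=
  Fintype.ofFinite _

/-- The star centered at `e`: all perfect matchings that contain the edge `e`. -/
def pmStar (n : ℕ) (e : KEdge n) : Set (PerfMatching n) :=
  {M | (e : Sym2 (Fin (2 * n))) ∈ M.1.edgeSet}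

/-- The indicator function of a set of perfect matchings, as a real vector. -/
noncomputable def indicatorVec {n : ℕ} (S : Set (PerfMatching n)) :
    EuclideanSpace ℝ (PerfMatching n) :=
  WithLp.toLp 2 (S.indicator 1)

/-- The linear span of the indicator functions of the stars. -/
noncomputable def starSpan (n : ℕ) : Submodule ℝ (EuclideanSpace ℝ (PerfMatching n)) :=
  Submodule.span ℝ (Set.range fun e : KEdge n => indicatorVec (pmStar n e))

/-- The normalized norm `‖f‖ = (|V|⁻¹ ∑ v, f v ^ 2) ^ (1/2)`. It is a constant multiple of the
Euclidean norm, so both give the same orthogonal projections. -/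
noncomputable def normalizedNorm {n : ℕ} (f : EuclideanSpace ℝ (PerfMatching n)) : ℝ :=
  Real.sqrt ((1 / (Fintype.card (PerfMatching n) : ℝ)) * ∑ M, f M ^ 2)

lemma sum_sum_sym2_mk {V M : Type*} [Fintype V] [AddCommMonoid M] {F : Sym2 V → M}
    (hd : ∀ e : Sym2 V, e.IsDiag → F e = 0) : ∑ a, ∑ b, F s(a, b) = 2 • ∑ e, F e := by
  classical
  rw [← Fintype.sum_prod_type', ← Finset.sum_fiberwise (g := fun p : V × V => s(p.1, p.2)),
    Finset.smul_sum]
  refine Finset.sum_congr rfl fun e _ => ?_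
  induction e with | h a b => ?_
  rcases eq_or_ne a b with rfl | hab
  · rw [hd s(a, a) rfl, smul_zero]
    refine Finset.sum_eq_zero fun p hp => ?_
    rw [(Finset.mem_filter.1 hp).2, hd s(a, a) rfl]
  · have hfiber : Finset.univ.filter (fun p : V × V => s(p.1, p.2) = s(a, b))
        = {(a, b), (b, a)} := by
      ext p
      simp [Prod.ext_iff]
    rw [hfiber, Finset.sum_pair (by simp [hab]), Sym2.eq_swap, two_smul]

lemma sum_sym2_eq_zero {V : Type*} [Fintype V] {Q : Sym2 V → ℝ}
    (hd : ∀ e : Sym2 V, e.IsDiag → Q e = 0) (hr : ∀ a, ∑ b, Q s(a, b) = 0) : ∑ e, Q e = 0 := by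
  simpa [hr] using sum_sum_sym2_mk hd

lemma sum_sym2_mem {V M : Type*} [Fintype V] [DecidableEq V] [AddCommMonoid M]
    (a : V) (F : Sym2 V → M) : ∑ e with a ∈ e, F e = ∑ b, F s(a, b) := by
  have himage : Finset.univ.filter (fun e : Sym2 V => a ∈ e)
      = Finset.univ.image fun b => s(a, b) := by
    ext e
    simp [Sym2.mem_iff_exists, eq_comm]
  rw [himage, Finset.sum_image fun b _ b' _ => Sym2.congr_right.1]

/-- Fixed-point-free involutions of `V`, that is, perfect matchings of the complete graph on `V`. -/
abbrev FPFInv (V : Type*) : Type _ :=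
  {π : Equiv.Perm V // (∀ v, π (π v) = v) ∧ ∀ v, π v ≠ v}

noncomputable instance instFintypeFPFInv (V : Type*) [Finite V] : Fintype (FPFInv V) :=
  Fintype.ofFinite _

namespace FPFInv

variable {V : Type*}

lemma apply_eq_iff (π : FPFInv V) {a b : V} : π.1 a = b ↔ π.1 b = a :=
  ⟨fun h => by rw [← h, π.2.1], fun h => by rw [← h, π.2.1]⟩

/-- Conjugation by `σ`, which relabels the vertices of a matching; conjugating by a transposition
switches two of its edges. -/
def conj (σ : Equiv.Perm V) : FPFInv V ≃ FPFInv V where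
  toFun π := ⟨σ * π.1 * σ⁻¹, fun v => by simp [π.2.1], fun v h =>
    π.2.2 (σ⁻¹ v) (σ.injective (by simpa using h))⟩
  invFun π := ⟨σ⁻¹ * π.1 * σ, fun v => by simp [π.2.1], fun v h =>
    π.2.2 (σ v) (σ⁻¹.injective (by simpa using h))⟩
  left_inv π := Subtype.ext (by simp [mul_assoc])
  right_inv π := Subtype.ext (by simp [mul_assoc])

lemma conj_apply_apply (σ : Equiv.Perm V) (π : FPFInv V) (v : V) :
    (conj σ π).1 (σ v) = σ (π.1 v) :=
  congrArg (fun x => σ (π.1 x)) (σ.symm_apply_apply v)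

variable [DecidableEq V]

lemma conj_swap_apply (π : FPFInv V) (u v x : V) :
    (conj (Equiv.swap u v) π).1 x = Equiv.swap u v (π.1 (Equiv.swap u v x)) := by
  rw [← conj_apply_apply, Equiv.swap_apply_self]

lemma conj_swap_conj_swap (π : FPFInv V) (u v : V) :
    conj (Equiv.swap u v) (conj (Equiv.swap u v) π) = π :=
  Subtype.ext (Equiv.ext fun x => by simp only [conj_swap_apply, Equiv.swap_apply_self])

lemma conj_swap_mate (π : FPFInv V) (u : V) : conj (Equiv.swap u (π.1 u)) π = π := by
  refine Subtype.ext (Equiv.ext fun x => ?_)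
  rw [conj_swap_apply, Equiv.swap_apply_eq_iff]
  have hswap : π.1 * Equiv.swap u (π.1 u) = Equiv.swap (π.1 u) (π.1 (π.1 u)) * π.1 :=
    Equiv.mul_swap_eq_swap_mul π.1 u (π.1 u)
  rw [π.2.1 u, Equiv.swap_comm (π.1 u)] at hswap
  exact Equiv.congr_fun hswap x

variable [Fintype V]

/-- The edges of the matching `π`. -/
def edges (π : FPFInv V) : Finset (Sym2 V) :=
  Finset.univ.image fun v => s(v, π.1 v)

lemma mk_mem_edges {π : FPFInv V} {a b : V} : s(a, b) ∈ π.edges ↔ π.1 a = b := by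
  simp only [edges, Finset.mem_image, Finset.mem_univ, true_and, Sym2.eq_iff]
  constructor
  · rintro ⟨v, ⟨rfl, rfl⟩ | ⟨rfl, rfl⟩⟩
    · rfl
    · exact π.2.1 v
  · rintro rfl
    exact ⟨a, Or.inl ⟨rfl, rfl⟩⟩

lemma map_mem_edges_conj {σ : Equiv.Perm V} {π : FPFInv V} {e : Sym2 V} :
    e.map σ ∈ (conj σ π).edges ↔ e ∈ π.edges := by
  induction e with | h a b => ?_
  rw [Sym2.map_mk, mk_mem_edges, mk_mem_edges, conj_apply_apply, σ.injective.eq_iff]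

lemma not_isDiag_of_mem_edges {π : FPFInv V} {e : Sym2 V} (h : e ∈ π.edges) : ¬e.IsDiag := by
  induction e with | h a b => ?_
  intro (hab : a = b)
  exact π.2.2 a (mk_mem_edges.1 h |>.trans hab.symm)

lemma eq_of_mem_edges {π : FPFInv V} {e e' : Sym2 V} (he : e ∈ π.edges) (he' : e' ∈ π.edges)
    {a : V} (ha : a ∈ e) (ha' : a ∈ e') : e = e' := by
  obtain ⟨b, rfl⟩ := ha
  obtain ⟨b', rfl⟩ := ha'
  rw [← mk_mem_edges.1 he, ← mk_mem_edges.1 he']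

/-- The indicator function of the star of the edge `e`. -/
def ind (e : Sym2 V) (π : FPFInv V) : ℝ := if e ∈ π.edges then 1 else 0

lemma ind_nonneg (e : Sym2 V) (π : FPFInv V) : 0 ≤ ind e π := by
  unfold ind
  positivity

lemma ind_eq_zero_of_isDiag {e : Sym2 V} (he : e.IsDiag) (π : FPFInv V) : ind e π = 0 :=
  if_neg fun h => not_isDiag_of_mem_edges h he

lemma ind_map_conj (σ : Equiv.Perm V) (e : Sym2 V) (π : FPFInv V) :
    ind (e.map σ) (conj σ π) = ind e π := by
  simp only [ind, map_mem_edges_conj]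

lemma ind_mul_self (e : Sym2 V) (π : FPFInv V) : ind e π * ind e π = ind e π := by
  unfold ind
  split_ifs <;> norm_num

lemma ind_mul_ind_eq_zero {e e' : Sym2 V} (h : e ≠ e') {a : V} (ha : a ∈ e) (ha' : a ∈ e')
    (π : FPFInv V) : ind e π * ind e' π = 0 := by
  by_contra h0
  have hmem : e ∈ π.edges ∧ e' ∈ π.edges := by simpa [ind, and_comm] using h0
  exact h (eq_of_mem_edges hmem.1 hmem.2 ha ha')

lemma sum_ind_mk (π : FPFInv V) (a : V) : ∑ b, ind s(a, b) π = 1 := by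
  simp [ind, mk_mem_edges]

/-- The total weight `∑ e ∈ π, F e` of the edges of the matching `π`. -/
def weight (F : Sym2 V → ℝ) (π : FPFInv V) : ℝ := ∑ e ∈ π.edges, F e

lemma weight_eq_sum_ind_mul (F : Sym2 V → ℝ) (π : FPFInv V) :
    weight F π = ∑ e, ind e π * F e := by
  simp [weight, ind]

lemma two_mul_weight (F : Sym2 V → ℝ) (π : FPFInv V) :
    2 * weight F π = ∑ v, F s(v, π.1 v) := by
  have h := sum_sum_sym2_mk (F := fun e => ind e π * F e) fun e he => by
    rw [ind_eq_zero_of_isDiag he, zero_mul]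
  rw [weight_eq_sum_ind_mul, ← Nat.cast_ofNat, ← nsmul_eq_mul, ← h]
  simp [ind, mk_mem_edges]

lemma weight_nonneg {F : Sym2 V → ℝ} (hF : ∀ e, 0 ≤ F e) (π : FPFInv V) : 0 ≤ weight F π :=
  Finset.sum_nonneg fun e _ => hF e

lemma sum_mul_weight (g : FPFInv V → ℝ) (F : Sym2 V → ℝ) :
    ∑ π, g π * weight F π = ∑ e, F e * ∑ π, ind e π * g π := by
  simp only [weight_eq_sum_ind_mul, Finset.mul_sum]
  rw [Finset.sum_comm]
  exact Finset.sum_congr rfl fun e _ => Finset.sum_congr rfl fun π _ => by ring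

lemma card_mul_sum_ind_mul (g : FPFInv V → ℝ) {D : Finset V} {c d : V} (hc : c ∉ D) (hd : d ∈ D)
    (hsupp : ∀ π, g π ≠ 0 → π.1 c ∈ D)
    (hinv : ∀ d' ∈ D, ∀ π, g (conj (Equiv.swap d d') π) = g π) :
    (D.card : ℝ) * ∑ π, ind s(c, d) π * g π = ∑ π, g π := by
  have hequi : ∀ d' ∈ D, ∑ π, ind s(c, d') π * g π = ∑ π, ind s(c, d) π * g π := by
    intro d' hd'
    have hmap : s(c, d') = Sym2.map (Equiv.swap d d') s(c, d) := by
      rw [Sym2.map_mk, Equiv.swap_apply_left,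
        Equiv.swap_apply_of_ne_of_ne (ne_of_mem_of_not_mem hd hc).symm
          (ne_of_mem_of_not_mem hd' hc).symm]
    rw [← Equiv.sum_comp (conj (Equiv.swap d d'))]
    exact Finset.sum_congr rfl fun π _ => by rw [hmap, ind_map_conj, hinv d' hd']
  have htotal : ∀ π, ∑ d' ∈ D, ind s(c, d') π * g π = g π := by
    intro π
    rcases eq_or_ne (g π) 0 with h0 | h0
    · simp [h0]
    · simp [ind, mk_mem_edges, hsupp π h0]
  calc (D.card : ℝ) * ∑ π, ind s(c, d) π * g π = ∑ d' ∈ D, ∑ π, ind s(c, d') π * g π := by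
        rw [Finset.sum_congr rfl hequi, Finset.sum_const, nsmul_eq_mul]
    _ = ∑ π, g π := by
        rw [Finset.sum_comm]
        exact Finset.sum_congr rfl fun π _ => htotal π

section Moments

variable {N w : ℝ}

lemma sum_ind (hN : (Fintype.card V : ℝ) = N + 1) (hN0 : N ≠ 0)
    (hw : (Fintype.card (FPFInv V) : ℝ) = N * w) {e : Sym2 V} (he : ¬e.IsDiag) :
    ∑ π, ind e π = w := by
  induction e with | h a b => ?_
  have hab : b ≠ a := fun h => he h.symm
  have hcard : ((Finset.univ.erase a).card : ℝ) = N := by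
    rw [Finset.cast_card_erase_of_mem (Finset.mem_univ a), Finset.card_univ, hN,
      add_sub_cancel_right]
  have h := card_mul_sum_ind_mul (fun _ => 1) (Finset.notMem_erase a Finset.univ)
    (Finset.mem_erase.2 ⟨hab, Finset.mem_univ b⟩) (fun π _ => by simp [π.2.2]) (by simp)
  simp only [hcard, mul_one, Finset.sum_const, Finset.card_univ, nsmul_eq_mul, hw] at h
  exact mul_left_cancel₀ hN0 h

lemma sum_ind_mul_ind_of_disjoint (hN : (Fintype.card V : ℝ) = N + 1) (hN2 : 2 < N)
    (hw : (Fintype.card (FPFInv V) : ℝ) = N * w) {e e' : Sym2 V} (he : ¬e.IsDiag)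
    (he' : ¬e'.IsDiag) (hdisj : ∀ x ∈ e, x ∉ e') :
    ∑ π, ind e π * ind e' π = w / (N - 2) := by
  have hsum := sum_ind hN (by linarith) hw he'
  induction e with | h c d => ?_
  induction e' with | h a b => ?_
  simp only [Sym2.mem_iff, forall_eq_or_imp, forall_eq, not_or] at hdisj
  obtain ⟨⟨hca, hcb⟩, hda, hdb⟩ := hdisj
  have hcd : d ≠ c := fun h => he h.symm
  have hab : a ≠ b := fun h => he' h
  have hthree : ({a, b, c} : Finset V).card = 3 := by
    simp [hab, Ne.symm hca, Ne.symm hcb]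
  have hcard : (({a, b, c}ᶜ : Finset V).card : ℝ) = N - 2 := by
    have := Finset.card_add_card_compl ({a, b, c} : Finset V)
    rw [hthree] at this
    have : (3 : ℝ) + (({a, b, c}ᶜ : Finset V).card : ℝ) = N + 1 := by rw [← hN]; exact_mod_cast this
    linarith
  have hsupp : ∀ π : FPFInv V, ind s(a, b) π ≠ 0 → π.1 c ∈ ({a, b, c}ᶜ : Finset V) := by
    intro π hπ
    have hπa : π.1 a = b := by
      by_contra h
      exact hπ (if_neg (mt mk_mem_edges.1 h))
    have hπb : π.1 b = a := π.apply_eq_iff.1 hπa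
    simp only [Finset.mem_compl, Finset.mem_insert, Finset.mem_singleton, not_or]
    refine ⟨fun h => hcb ?_, fun h => hca ?_, π.2.2 c⟩
    · rw [← hπa, π.apply_eq_iff.1 h]
    · rw [← hπb, π.apply_eq_iff.1 h]
  have hinv : ∀ d' ∈ ({a, b, c}ᶜ : Finset V), ∀ π,
      ind s(a, b) (conj (Equiv.swap d d') π) = ind s(a, b) π := by
    intro d' hd' π
    simp only [Finset.mem_compl, Finset.mem_insert, Finset.mem_singleton, not_or] at hd'
    rw [← ind_map_conj (Equiv.swap d d') s(a, b) π, Sym2.map_mk,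
      Equiv.swap_apply_of_ne_of_ne (Ne.symm hda) (Ne.symm hd'.1),
      Equiv.swap_apply_of_ne_of_ne (Ne.symm hdb) (Ne.symm hd'.2.1)]
  have h := card_mul_sum_ind_mul (ind s(a, b)) (c := c) (d := d) (by simp) (by simp [*]) hsupp hinv
  rwa [hcard, hsum, mul_comm, ← eq_div_iff (by linarith)] at h

lemma sum_ind_mul_ind_le (hN : (Fintype.card V : ℝ) = N + 1) (hN2 : 2 < N)
    (hw : (Fintype.card (FPFInv V) : ℝ) = N * w) (hw0 : 0 ≤ w) {e e' : Sym2 V} (h : e ≠ e') :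
    ∑ π, ind e π * ind e' π ≤ w / (N - 2) := by
  have hnonneg : 0 ≤ w / (N - 2) := div_nonneg hw0 (by linarith)
  by_cases he : e.IsDiag
  · simpa [ind_eq_zero_of_isDiag he] using hnonneg
  by_cases he' : e'.IsDiag
  · simpa [ind_eq_zero_of_isDiag he'] using hnonneg
  by_cases hdisj : ∀ x ∈ e, x ∉ e'
  · exact (sum_ind_mul_ind_of_disjoint hN hN2 hw he he' hdisj).le
  · push Not at hdisj
    obtain ⟨a, ha, ha'⟩ := hdisj
    rwa [Finset.sum_eq_zero fun π _ => ind_mul_ind_eq_zero h ha ha' π]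

lemma sum_ind_mul_ind (hN : (Fintype.card V : ℝ) = N + 1) (hN2 : 2 < N)
    (hw : (Fintype.card (FPFInv V) : ℝ) = N * w) {a b : V} (hab : a ≠ b)
    {e : Sym2 V} (he : ¬e.IsDiag) :
    ∑ π, ind s(a, b) π * ind e π = w / (N - 2) *
      (1 - (if a ∈ e then 1 else 0) - (if b ∈ e then 1 else 0)
        + (N - 1) * if e = s(a, b) then 1 else 0) := by
  rcases eq_or_ne e s(a, b) with rfl | hne
  · simp only [ind_mul_self, sum_ind hN (by linarith) hw he, Sym2.mem_iff, true_or, or_true,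
      if_true]
    have : N - 2 ≠ 0 := by linarith
    field_simp
    ring
  by_cases hdisj : ∀ x ∈ s(a, b), x ∉ e
  · rw [sum_ind_mul_ind_of_disjoint hN hN2 hw (mt Sym2.mk_isDiag_iff.1 hab) he hdisj,
      if_neg (hdisj a (by simp)), if_neg (hdisj b (by simp)), if_neg hne]
    ring
  · push Not at hdisj
    obtain ⟨x, hx, hxe⟩ := hdisj
    rw [Finset.sum_eq_zero fun π _ => ind_mul_ind_eq_zero (Ne.symm hne) hx hxe π]
    have hnot : ¬(a ∈ e ∧ b ∈ e) := mt (Sym2.mem_and_mem_iff hab).1 hne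
    have hor : a ∈ e ∨ b ∈ e := by
      rcases Sym2.mem_iff.1 hx with rfl | rfl
      exacts [Or.inl hxe, Or.inr hxe]
    rw [if_neg hne]
    split_ifs <;> simp_all

lemma sum_weight (hN : (Fintype.card V : ℝ) = N + 1) (hN0 : N ≠ 0)
    (hw : (Fintype.card (FPFInv V) : ℝ) = N * w) {F : Sym2 V → ℝ}
    (hd : ∀ e : Sym2 V, e.IsDiag → F e = 0) :
    ∑ π, weight F π = w * ∑ e, F e := by
  have h := sum_mul_weight (fun _ => 1) F
  simp only [one_mul, mul_one] at h
  rw [h, Finset.mul_sum]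
  refine Finset.sum_congr rfl fun e _ => ?_
  by_cases he : e.IsDiag
  · rw [hd e he]
    ring
  · rw [sum_ind hN hN0 hw he, mul_comm]

lemma sum_ind_mul_weight (hN : (Fintype.card V : ℝ) = N + 1) (hN2 : 2 < N)
    (hw : (Fintype.card (FPFInv V) : ℝ) = N * w) {Q : Sym2 V → ℝ}
    (hd : ∀ e : Sym2 V, e.IsDiag → Q e = 0) (hr : ∀ a, ∑ b, Q s(a, b) = 0)
    {e : Sym2 V} (he : ¬e.IsDiag) :
    ∑ π, ind e π * weight Q π = w * ((N - 1) / (N - 2)) * Q e := by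
  induction e with | h a b => ?_
  have hterm : ∀ e', Q e' * ∑ π, ind e' π * ind s(a, b) π = w / (N - 2) *
      (Q e' - (if a ∈ e' then Q e' else 0) - (if b ∈ e' then Q e' else 0)
        + (N - 1) * if e' = s(a, b) then Q e' else 0) := by
    intro e'
    by_cases he' : e'.IsDiag
    · simp [hd e' he']
    · simp only [mul_comm (ind e' _), sum_ind_mul_ind hN hN2 hw he he']
      split_ifs <;> ring
  rw [sum_mul_weight, Finset.sum_congr rfl fun e' _ => hterm e', ← Finset.mul_sum,
    Finset.sum_add_distrib, Finset.sum_sub_distrib, Finset.sum_sub_distrib, ← Finset.mul_sum,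
    ← Finset.sum_filter, ← Finset.sum_filter, sum_sym2_mem, sum_sym2_mem, hr, hr,
    sum_sym2_eq_zero hd hr, Finset.sum_ite_eq' Finset.univ, if_pos (Finset.mem_univ _)]
  ring

lemma sum_sq_weight (hN : (Fintype.card V : ℝ) = N + 1) (hN2 : 2 < N)
    (hw : (Fintype.card (FPFInv V) : ℝ) = N * w) {Q : Sym2 V → ℝ}
    (hd : ∀ e : Sym2 V, e.IsDiag → Q e = 0) (hr : ∀ a, ∑ b, Q s(a, b) = 0) :
    ∑ π, weight Q π ^ 2 = w * ((N - 1) / (N - 2)) * ∑ e, Q e ^ 2 := by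
  simp only [pow_two (weight Q _)]
  rw [sum_mul_weight, Finset.mul_sum]
  refine Finset.sum_congr rfl fun e _ => ?_
  by_cases he : e.IsDiag
  · rw [hd e he]
    ring
  · rw [sum_ind_mul_weight hN hN2 hw hd hr he]
    ring

lemma sum_ind_mul_weight_le (hN : (Fintype.card V : ℝ) = N + 1) (hN2 : 2 < N)
    (hw : (Fintype.card (FPFInv V) : ℝ) = N * w) (hw0 : 0 ≤ w) {F : Sym2 V → ℝ}
    (hF : ∀ e, 0 ≤ F e) (e : Sym2 V) :
    ∑ π, ind e π * weight F π ≤ w * F e + w / (N - 2) * ∑ e, F e := by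
  have hdiag : ∑ π, ind e π ≤ w := by
    by_cases he : e.IsDiag
    · simpa [ind_eq_zero_of_isDiag he] using hw0
    · exact (sum_ind hN (by linarith) hw he).le
  have hq : 0 ≤ w / (N - 2) := div_nonneg hw0 (by linarith)
  have hterm : ∀ e', F e' * ∑ π, ind e' π * ind e π ≤
      (if e' = e then w * F e' else 0) + w / (N - 2) * F e' := by
    intro e'
    rcases eq_or_ne e' e with rfl | hne
    · simp only [ind_mul_self, if_true]
      nlinarith [hF e', mul_nonneg hq (hF e')]
    · rw [if_neg hne, zero_add, mul_comm]
      exact mul_le_mul_of_nonneg_right (sum_ind_mul_ind_le hN hN2 hw hw0 hne) (hF e')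
  rw [sum_mul_weight]
  refine (Finset.sum_le_sum fun e' _ => hterm e').trans_eq ?_
  rw [Finset.sum_add_distrib, ← Finset.mul_sum, Finset.sum_ite_eq' Finset.univ,
    if_pos (Finset.mem_univ _)]

lemma sum_sq_weight_le (hN : (Fintype.card V : ℝ) = N + 1) (hN2 : 2 < N)
    (hw : (Fintype.card (FPFInv V) : ℝ) = N * w) (hw0 : 0 ≤ w) {F : Sym2 V → ℝ}
    (hF : ∀ e, 0 ≤ F e) :
    ∑ π, weight F π ^ 2 ≤ w * ∑ e, F e ^ 2 + w / (N - 2) * (∑ e, F e) ^ 2 := by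
  simp only [pow_two (weight F _)]
  rw [sum_mul_weight]
  calc ∑ e, F e * ∑ π, ind e π * weight F π
      ≤ ∑ e, F e * (w * F e + w / (N - 2) * ∑ e, F e) := Finset.sum_le_sum fun e _ =>
        mul_le_mul_of_nonneg_left (sum_ind_mul_weight_le hN hN2 hw hw0 hF e) (hF e)
    _ = ∑ e, (w * F e ^ 2 + w / (N - 2) * (∑ e, F e) * F e) :=
        Finset.sum_congr rfl fun e _ => by ring
    _ = w * ∑ e, F e ^ 2 + w / (N - 2) * (∑ e, F e) ^ 2 := by
        rw [Finset.sum_add_distrib, ← Finset.mul_sum, ← Finset.mul_sum]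
        ring

end Moments

end FPFInv

lemma sq_posPart_sub_mul_sub_le (x y : ℝ) :
    (max x 0 ^ 2 - max y 0 ^ 2) * (x - y) ≤ (max x 0 + max y 0) * (x - y) ^ 2 := by
  have hcontract : (max x 0 - max y 0) * (x - y) ≤ (x - y) ^ 2 := by
    rcases le_total x 0 with hx | hx <;> rcases le_total y 0 with hy | hy <;>
      simp only [max_eq_left, max_eq_right, hx, hy] <;> nlinarith
  calc (max x 0 ^ 2 - max y 0 ^ 2) * (x - y)
      = (max x 0 + max y 0) * ((max x 0 - max y 0) * (x - y)) := by ring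
    _ ≤ (max x 0 + max y 0) * (x - y) ^ 2 := mul_le_mul_of_nonneg_left hcontract (by positivity)

lemma max_zero_sq_mul_self (x : ℝ) : max x 0 ^ 2 * x = max x 0 ^ 3 := by
  rcases le_total x 0 with hx | hx
  · simp [hx]
  · rw [max_eq_left hx, ← pow_succ]

lemma max_zero_mul_sq (x : ℝ) : max x 0 * x ^ 2 = max x 0 ^ 3 := by
  rcases le_total x 0 with hx | hx
  · simp [hx]
  · rw [max_eq_left hx, ← pow_succ']

-- Exchangeable pairs: averaging over `ω` and `τ ω` turns both sides into symmetric forms.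
lemma sum_sq_posPart_mul_sub_le {Ω : Type*} [Fintype Ω] {τ : Ω → Ω} (hτ : Function.Involutive τ)
    (Y : Ω → ℝ) :
    ∑ ω, max (Y ω) 0 ^ 2 * (Y ω - Y (τ ω)) ≤ ∑ ω, max (Y ω) 0 * (Y ω - Y (τ ω)) ^ 2 := by
  have hflip : ∀ H : ℝ → ℝ → ℝ, ∑ ω, H (Y (τ ω)) (Y ω) = ∑ ω, H (Y ω) (Y (τ ω)) := fun H => by
    rw [← hτ.bijective.sum_comp]
    simp only [hτ _]
  have hleft := hflip fun x y => max x 0 ^ 2 * (x - y)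
  have hright := hflip fun x y => max x 0 * (x - y) ^ 2
  have hpointwise := Finset.sum_le_sum fun ω (_ : ω ∈ Finset.univ) =>
    sq_posPart_sub_mul_sub_le (Y ω) (Y (τ ω))
  have hL : ∀ ω, (max (Y ω) 0 ^ 2 - max (Y (τ ω)) 0 ^ 2) * (Y ω - Y (τ ω)) =
      max (Y ω) 0 ^ 2 * (Y ω - Y (τ ω)) + max (Y (τ ω)) 0 ^ 2 * (Y (τ ω) - Y ω) := fun ω => by ring
  have hR : ∀ ω, (max (Y ω) 0 + max (Y (τ ω)) 0) * (Y ω - Y (τ ω)) ^ 2 =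
      max (Y ω) 0 * (Y ω - Y (τ ω)) ^ 2 + max (Y (τ ω)) 0 * (Y (τ ω) - Y ω) ^ 2 :=
    fun ω => by ring
  simp only [hL, hR, Finset.sum_add_distrib] at hpointwise
  linarith

lemma mul_sum_posPart_cube_le {Ω ι : Type*} [Fintype Ω] [Fintype ι] {τ : ι → Ω → Ω}
    (hτ : ∀ i, Function.Involutive (τ i)) {Y : Ω → ℝ} {κ : ℝ}
    (hY : ∀ ω, ∑ i, (Y ω - Y (τ i ω)) = κ * Y ω) :
    κ * ∑ ω, max (Y ω) 0 ^ 3 ≤ ∑ ω, max (Y ω) 0 * ∑ i, (Y ω - Y (τ i ω)) ^ 2 := by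
  calc κ * ∑ ω, max (Y ω) 0 ^ 3 = ∑ ω, max (Y ω) 0 ^ 2 * ∑ i, (Y ω - Y (τ i ω)) := by
        rw [Finset.mul_sum]
        exact Finset.sum_congr rfl fun ω _ => by rw [hY, ← max_zero_sq_mul_self]; ring
    _ = ∑ i, ∑ ω, max (Y ω) 0 ^ 2 * (Y ω - Y (τ i ω)) := by
        simp only [Finset.mul_sum]
        exact Finset.sum_comm
    _ ≤ ∑ i, ∑ ω, max (Y ω) 0 * (Y ω - Y (τ i ω)) ^ 2 :=
        Finset.sum_le_sum fun i _ => sum_sq_posPart_mul_sub_le (hτ i) Y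
    _ = ∑ ω, max (Y ω) 0 * ∑ i, (Y ω - Y (τ i ω)) ^ 2 := by
        simp only [Finset.mul_sum]
        exact Finset.sum_comm

section CycleType

variable {V : Type*} [Fintype V] [DecidableEq V]

lemma cycleType_eq_replicate_two_iff {n : ℕ} (hV : Fintype.card V = 2 * n) {σ : Equiv.Perm V} :
    σ.cycleType = Multiset.replicate n 2 ↔ (∀ v, σ (σ v) = v) ∧ ∀ v, σ v ≠ v := by
  have hsq : (∀ v, σ (σ v) = v) ↔ σ ^ 2 = 1 := by simp [Equiv.ext_iff, pow_two]
  have hsupport : (∀ v, σ v ≠ v) ↔ σ.support.card = Fintype.card V := by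
    simp [Finset.card_eq_iff_eq_univ, Finset.eq_univ_iff_forall]
  rw [hsq, hsupport, hV, ← σ.sum_cycleType]
  constructor
  · intro h
    have horder : orderOf σ ∣ 2 := by
      rw [← Equiv.Perm.lcm_cycleType, h, Multiset.lcm_dvd]
      exact fun b hb => (Multiset.eq_of_mem_replicate hb).dvd
    exact ⟨orderOf_dvd_iff_pow_eq_one.1 horder, by simp [h, mul_comm]⟩
  · rintro ⟨h2, hcard⟩
    have : Fact (Nat.Prime 2) := ⟨Nat.prime_two⟩
    have htype := Equiv.Perm.cycleType_of_pow_prime_eq_one h2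
    rw [htype, Multiset.sum_replicate, smul_eq_mul, mul_comm 2 n] at hcard
    rw [htype, Nat.eq_of_mul_eq_mul_right two_pos hcard]

lemma card_cycleType_eq_replicate_two_mul (n : ℕ) (hV : Fintype.card V = 2 * n) :
    ({σ | σ.cycleType = Multiset.replicate n 2} : Finset (Equiv.Perm V)).card * (2 ^ n * n !)
      = (2 * n)! := by
  have h := Equiv.Perm.card_of_cycleType_mul_eq V (Multiset.replicate n 2)
  have hcount : ∏ k ∈ (Multiset.replicate n 2).toFinset, ((Multiset.replicate n 2).count k)!
      = n ! := by
    rcases n.eq_zero_or_pos with rfl | hn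
    · simp
    · simp [Multiset.toFinset_replicate, hn.ne']
  rw [hcount, if_pos ⟨by simp [hV, mul_comm], fun a ha => (Multiset.eq_of_mem_replicate ha).ge⟩,
    hV] at h
  simpa [mul_comm n 2] using h

end CycleType

namespace FPFInv

lemma card_eq_doubleFactorial {V : Type*} [Fintype V] {n : ℕ} (hV : Fintype.card V = 2 * n) :
    Fintype.card (FPFInv V) = (2 * n - 1)‼ := by
  classical
  have hcycle : Fintype.card (FPFInv V) =
      ({σ | σ.cycleType = Multiset.replicate n 2} : Finset (Equiv.Perm V)).card := by
    rw [Fintype.card_of_subtype]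
    exact fun σ => by simpa using cycleType_eq_replicate_two_iff hV
  have hmul := card_cycleType_eq_replicate_two_mul n hV
  rw [← hcycle] at hmul
  rcases n.eq_zero_or_pos with rfl | hn
  · simpa using hmul
  · have hfact := Nat.factorial_eq_mul_doubleFactorial (2 * n - 1)
    rw [Nat.sub_add_cancel (by omega), Nat.doubleFactorial_two_mul, ← hmul, mul_comm] at hfact
    exact Nat.eq_of_mul_eq_mul_left (by positivity) hfact

variable {V : Type*} [Fintype V] [DecidableEq V]

lemma two_mul_weight_conj (σ : Equiv.Perm V) (F : Sym2 V → ℝ) (π : FPFInv V) :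
    2 * weight F (conj σ π) = ∑ v, F s(σ v, σ (π.1 v)) := by
  rw [two_mul_weight, ← Equiv.sum_comp σ]
  simp only [conj_apply_apply]

lemma weight_conj_swap_of_ne (F : Sym2 V → ℝ) (π : FPFInv V) {u v : V} (huv : u ≠ v)
    (hmate : π.1 u ≠ v) :
    weight F (conj (Equiv.swap u v) π) =
      weight F π - F s(u, π.1 u) - F s(v, π.1 v) + F s(u, π.1 v) + F s(v, π.1 u) := by
  have hmate' : π.1 v ≠ u := mt π.apply_eq_iff.1 hmate
  have hmates : π.1 u ≠ π.1 v := π.1.injective.ne huv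
  have hdiff : 2 * weight F (conj (Equiv.swap u v) π) - 2 * weight F π =
      ∑ y ∈ {u, v, π.1 u, π.1 v},
        (F s(Equiv.swap u v y, Equiv.swap u v (π.1 y)) - F s(y, π.1 y)) := by
    rw [two_mul_weight_conj, two_mul_weight, ← Finset.sum_sub_distrib]
    refine (Finset.sum_subset (Finset.subset_univ _) fun y _ hy => ?_).symm
    simp only [Finset.mem_insert, Finset.mem_singleton, not_or] at hy
    obtain ⟨hyu, hyv, hyu', hyv'⟩ := hy
    rw [Equiv.swap_apply_of_ne_of_ne hyu hyv, Equiv.swap_apply_of_ne_of_ne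
      (fun h => hyu' (π.apply_eq_iff.1 h).symm) (fun h => hyv' (π.apply_eq_iff.1 h).symm), sub_self]
  rw [Finset.sum_insert (by simp [huv, hmate'.symm, (π.2.2 u).symm]),
    Finset.sum_insert (by simp [hmate.symm, (π.2.2 v).symm]),
    Finset.sum_pair hmates] at hdiff
  simp only [π.2.1, Equiv.swap_apply_left, Equiv.swap_apply_right,
    Equiv.swap_apply_of_ne_of_ne (π.2.2 u) hmate, Equiv.swap_apply_of_ne_of_ne hmate' (π.2.2 v),
    Sym2.eq_swap (a := π.1 _)] at hdiff
  linarith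

lemma weight_sub_weight_conj_swap {F : Sym2 V → ℝ} (hd : ∀ e : Sym2 V, e.IsDiag → F e = 0)
    (π : FPFInv V) (u v : V) :
    weight F π - weight F (conj (Equiv.swap u v) π) =
      F s(u, π.1 u) + F s(v, π.1 v) - F s(u, π.1 v) - F s(v, π.1 u)
        - if π.1 u = v then 2 * F s(u, π.1 u) else 0 := by
  by_cases hmate : π.1 u = v
  · subst hmate
    rw [conj_swap_mate, if_pos rfl, π.2.1 u, hd s(u, u) rfl, hd s(π.1 u, π.1 u) rfl,
      Sym2.eq_swap (a := π.1 u)]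
    ring
  rw [if_neg hmate]
  rcases eq_or_ne u v with rfl | huv
  · rw [Equiv.swap_self, ← Equiv.Perm.one_def]
    simp [conj]
  · rw [weight_conj_swap_of_ne F π huv hmate]
    ring

section Stein

variable {N : ℝ} {Q : Sym2 V → ℝ}

lemma sum_sub_weight_conj_swap (hN : (Fintype.card V : ℝ) = N + 1)
    (hd : ∀ e : Sym2 V, e.IsDiag → Q e = 0) (hr : ∀ a, ∑ b, Q s(a, b) = 0) (π : FPFInv V) :
    ∑ p : V × V, (weight Q π - weight Q (conj (Equiv.swap p.1 p.2) π)) = 4 * N * weight Q π := by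
  have hrow : ∀ u, ∑ v, Q s(u, π.1 v) = 0 := fun u => by
    rw [Equiv.sum_comp π.1 fun v => Q s(u, v), hr]
  have hrow' : ∀ u, ∑ v, Q s(v, u) = 0 := fun u => by simpa only [Sym2.eq_swap] using hr u
  simp only [Fintype.sum_prod_type, weight_sub_weight_conj_swap hd, Finset.sum_sub_distrib,
    Finset.sum_add_distrib, Finset.sum_ite_eq, Finset.mem_univ, if_true, hrow, hrow',
    Finset.sum_const, Finset.card_univ, nsmul_eq_mul, ← Finset.mul_sum, ← two_mul_weight, hN]
  ring

lemma sq_sub_weight_conj_swap_le (hd : ∀ e : Sym2 V, e.IsDiag → Q e = 0) (π : FPFInv V) (u v : V) :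
    (weight Q π - weight Q (conj (Equiv.swap u v) π)) ^ 2 ≤
      Q s(u, π.1 u) ^ 2 + Q s(v, π.1 v) ^ 2 + 2 * (Q s(u, π.1 u) * Q s(v, π.1 v))
        - 2 * (Q s(u, π.1 u) * Q s(u, π.1 v)) - 2 * (Q s(u, π.1 u) * Q s(v, π.1 u))
        - 2 * (Q s(v, π.1 v) * Q s(u, π.1 v)) - 2 * (Q s(v, π.1 v) * Q s(v, π.1 u))
        + 2 * Q s(u, π.1 v) ^ 2 + 2 * Q s(v, π.1 u) ^ 2
        - if π.1 u = v then 4 * Q s(u, π.1 u) ^ 2 else 0 := by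
  rw [weight_sub_weight_conj_swap hd]
  split_ifs with hmate
  · subst hmate
    rw [π.2.1 u, hd s(u, u) rfl, hd s(π.1 u, π.1 u) rfl, Sym2.eq_swap (a := π.1 u)]
    exact le_of_eq (by ring)
  · nlinarith [sq_nonneg (Q s(u, π.1 v) - Q s(v, π.1 u))]

lemma sum_sq_sub_weight_conj_swap_le (hN : (Fintype.card V : ℝ) = N + 1)
    (hd : ∀ e : Sym2 V, e.IsDiag → Q e = 0) (hr : ∀ a, ∑ b, Q s(a, b) = 0) (π : FPFInv V) :
    ∑ p : V × V, (weight Q π - weight Q (conj (Equiv.swap p.1 p.2) π)) ^ 2 ≤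
      4 * (N - 1) * weight (fun e => Q e ^ 2) π + 8 * ∑ e, Q e ^ 2 + 8 * weight Q π ^ 2 := by
  have hr' : ∀ a, ∑ b, Q s(b, a) = 0 := fun a => by simpa only [Sym2.eq_swap] using hr a
  have hcross : ∀ a, ∑ b, Q s(a, π.1 b) = 0 := fun a => by
    rw [Equiv.sum_comp π.1 fun b => Q s(a, b), hr]
  have hcross' : ∀ a, ∑ b, Q s(b, π.1 a) = 0 := fun a => hr' _
  have hcol : ∑ u, ∑ v, Q s(v, π.1 v) * Q s(u, π.1 v) = 0 := by
    rw [Finset.sum_comm]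
    simp only [← Finset.mul_sum, hr', mul_zero, Finset.sum_const_zero]
  have hcol' : ∑ u, ∑ v, Q s(v, π.1 v) * Q s(v, π.1 u) = 0 := by
    rw [Finset.sum_comm]
    simp only [← Finset.mul_sum, hcross, mul_zero, Finset.sum_const_zero]
  have hsq : ∑ u, ∑ v, Q s(u, v) ^ 2 = 2 * ∑ e, Q e ^ 2 := by
    simpa using sum_sum_sym2_mk (F := fun e => Q e ^ 2) fun e he => by simp [hd e he]
  have hsq₁ : ∑ u, ∑ v, Q s(u, π.1 v) ^ 2 = 2 * ∑ e, Q e ^ 2 := by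
    rw [← hsq]
    exact Finset.sum_congr rfl fun u _ => Equiv.sum_comp π.1 fun v => Q s(u, v) ^ 2
  have hsq₂ : ∑ u, ∑ v, Q s(v, π.1 u) ^ 2 = 2 * ∑ e, Q e ^ 2 := by
    rw [Finset.sum_comm, hsq₁]
  rw [Fintype.sum_prod_type]
  refine (Finset.sum_le_sum fun u _ => Finset.sum_le_sum fun v _ =>
    sq_sub_weight_conj_swap_le hd π u v).trans_eq ?_
  simp only [Finset.sum_sub_distrib, Finset.sum_add_distrib, ← Finset.mul_sum, Finset.sum_ite_eq,
    Finset.mem_univ, if_true, Finset.sum_const, Finset.card_univ, nsmul_eq_mul, hcross, hcross',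
    hcol, hcol', hsq₁, hsq₂, ← Finset.sum_mul, ← two_mul_weight, hN,
    ← two_mul_weight (fun e => Q e ^ 2)]
  ring

lemma sum_posPart_cube_weight_le (hN : (Fintype.card V : ℝ) = N + 1)
    (hd : ∀ e : Sym2 V, e.IsDiag → Q e = 0) (hr : ∀ a, ∑ b, Q s(a, b) = 0) :
    (N - 2) * ∑ π : FPFInv V, max (weight Q π) 0 ^ 3 ≤
      (N - 1) * ∑ π : FPFInv V, max (weight Q π) 0 * weight (fun e => Q e ^ 2) π
        + 2 * (∑ e, Q e ^ 2) * ∑ π : FPFInv V, max (weight Q π) 0 := by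
  have hDirichlet := mul_sum_posPart_cube_le (τ := fun p : V × V => conj (Equiv.swap p.1 p.2))
    (fun p π => conj_swap_conj_swap π p.1 p.2) (sum_sub_weight_conj_swap hN hd hr)
  have hsq := Finset.sum_le_sum fun (π : FPFInv V) (_ : π ∈ Finset.univ) =>
    mul_le_mul_of_nonneg_left (sum_sq_sub_weight_conj_swap_le hN hd hr π)
      (le_max_right (weight Q π) 0)
  have hexpand : ∀ π, max (weight Q π) 0 * (4 * (N - 1) * weight (fun e => Q e ^ 2) π
        + 8 * ∑ e, Q e ^ 2 + 8 * weight Q π ^ 2) =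
      4 * (N - 1) * (max (weight Q π) 0 * weight (fun e => Q e ^ 2) π)
        + 8 * (∑ e, Q e ^ 2) * max (weight Q π) 0 + 8 * max (weight Q π) 0 ^ 3 := fun π => by
    rw [← max_zero_mul_sq]
    ring
  simp only [hexpand, Finset.sum_add_distrib, ← Finset.mul_sum] at hsq
  linarith

end Stein

/-- The density of `f` on the star of the edge `e`, where `w` is the size of a star. -/
noncomputable def density (w : ℝ) (f : FPFInv V → ℝ) (e : Sym2 V) : ℝ :=
  (∑ π, ind e π * f π) / w

/-- The star densities of `f` recentered by `t`. They are set to `0` on the loops `s(a, a)`, so that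
they are weights on the edges of the complete graph. -/
noncomputable def centered (w t : ℝ) (f : FPFInv V → ℝ) (e : Sym2 V) : ℝ :=
  if e.IsDiag then 0 else density w f e - t

/-- The sum of the squared recentered star densities of `f`. -/
noncomputable def energy (w t : ℝ) (f : FPFInv V → ℝ) : ℝ := ∑ e, centered w t f e ^ 2

/-- The orthogonal projection onto the span of the stars of a function `f` with sum `c * w`, for
`N + 1` vertices and stars of size `w`, in closed form. -/
noncomputable def starFit (N w c : ℝ) (f : FPFInv V → ℝ) (π : FPFInv V) : ℝ :=
  c / N + (N - 2) / (N - 1) * weight (centered w (c / N) f) π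

section Density

variable {N w c t : ℝ} {f : FPFInv V → ℝ}

lemma density_nonneg (hw0 : 0 ≤ w) (hf : ∀ π, 0 ≤ f π) (e : Sym2 V) : 0 ≤ density w f e :=
  div_nonneg (Finset.sum_nonneg fun π _ => mul_nonneg (ind_nonneg e π) (hf π)) hw0

lemma density_of_isDiag {e : Sym2 V} (he : e.IsDiag) : density w f e = 0 := by
  simp [density, ind_eq_zero_of_isDiag he]

lemma density_le_one (hN : (Fintype.card V : ℝ) = N + 1) (hN0 : N ≠ 0)
    (hw : (Fintype.card (FPFInv V) : ℝ) = N * w) (hw0 : 0 < w) (hf : ∀ π, f π ≤ 1)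
    (e : Sym2 V) : density w f e ≤ 1 := by
  by_cases he : e.IsDiag
  · simp [density_of_isDiag he]
  rw [density, div_le_one hw0, ← sum_ind hN hN0 hw he]
  exact Finset.sum_le_sum fun π _ => mul_le_of_le_one_right (ind_nonneg e π) (hf π)

lemma sum_density_mk (hw0 : w ≠ 0) (hc : ∑ π, f π = c * w) (a : V) :
    ∑ b, density w f s(a, b) = c := by
  simp only [density]
  rw [← Finset.sum_div, Finset.sum_comm, div_eq_iff hw0, ← hc]
  exact Finset.sum_congr rfl fun π _ => by rw [← Finset.sum_mul, sum_ind_mk, one_mul]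

lemma centered_of_isDiag {e : Sym2 V} (he : e.IsDiag) : centered w t f e = 0 := if_pos he

lemma centered_of_not_isDiag {e : Sym2 V} (he : ¬e.IsDiag) :
    centered w t f e = density w f e - t := if_neg he

lemma sum_centered_mk (hN : (Fintype.card V : ℝ) = N + 1) (hN0 : N ≠ 0) (hw0 : w ≠ 0)
    (hc : ∑ π, f π = c * w) (a : V) : ∑ b, centered w (c / N) f s(a, b) = 0 := by
  have hsplit : ∀ b, centered w (c / N) f s(a, b) =
      density w f s(a, b) - c / N + if a = b then c / N else 0 := by
    intro b
    rcases eq_or_ne a b with rfl | hab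
    · have haa : (s(a, a) : Sym2 V).IsDiag := Sym2.mk_isDiag_iff.2 rfl
      rw [centered_of_isDiag haa, density_of_isDiag haa, if_pos rfl, zero_sub, neg_add_cancel]
    · rw [centered_of_not_isDiag (mt Sym2.mk_isDiag_iff.1 hab), if_neg hab, add_zero]
  simp only [hsplit, Finset.sum_add_distrib, Finset.sum_sub_distrib, sum_density_mk hw0 hc,
    Finset.sum_ite_eq, Finset.mem_univ, if_true, Finset.sum_const, Finset.card_univ, hN,
    nsmul_eq_mul]
  field_simp
  ring

lemma centered_sq_le_one (hN : (Fintype.card V : ℝ) = N + 1) (hN0 : N ≠ 0)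
    (hw : (Fintype.card (FPFInv V) : ℝ) = N * w) (hw0 : 0 < w) (hf0 : ∀ π, 0 ≤ f π)
    (hf1 : ∀ π, f π ≤ 1) (ht0 : 0 ≤ t) (ht1 : t ≤ 1) (e : Sym2 V) :
    centered w t f e ^ 2 ≤ 1 := by
  by_cases he : e.IsDiag
  · simp [centered_of_isDiag he]
  · rw [centered_of_not_isDiag he, sq_le_one_iff_abs_le_one, abs_le]
    have := density_nonneg hw0.le hf0 e
    have := density_le_one hN hN0 hw hw0 hf1 e
    constructor <;> linarith

lemma energy_nonneg : 0 ≤ energy w t f := Finset.sum_nonneg fun _ _ => sq_nonneg _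

lemma sum_mul_weight_eq_density (hw0 : w ≠ 0) (F : Sym2 V → ℝ) :
    ∑ π, f π * weight F π = w * ∑ e, F e * density w f e := by
  rw [sum_mul_weight, Finset.mul_sum]
  refine Finset.sum_congr rfl fun e _ => ?_
  rw [density]
  field_simp

lemma sum_centered (hN : (Fintype.card V : ℝ) = N + 1) (hN0 : N ≠ 0) (hw0 : w ≠ 0)
    (hc : ∑ π, f π = c * w) : ∑ e, centered w (c / N) f e = 0 :=
  sum_sym2_eq_zero (fun _ => centered_of_isDiag) (sum_centered_mk hN hN0 hw0 hc)

lemma sum_mul_weight_centered (hN : (Fintype.card V : ℝ) = N + 1) (hN0 : N ≠ 0) (hw0 : w ≠ 0)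
    (hc : ∑ π, f π = c * w) :
    ∑ π, f π * weight (centered w (c / N) f) π = w * energy w (c / N) f := by
  have hterm : ∀ e, centered w (c / N) f e * density w f e =
      centered w (c / N) f e ^ 2 + c / N * centered w (c / N) f e := by
    intro e
    by_cases he : e.IsDiag
    · simp [centered_of_isDiag he]
    · rw [centered_of_not_isDiag he]
      ring
  rw [sum_mul_weight_eq_density hw0, Finset.sum_congr rfl fun e _ => hterm e,
    Finset.sum_add_distrib, ← Finset.mul_sum, sum_centered hN hN0 hw0 hc, mul_zero, add_zero,
    energy]

end Density

section Energy

variable {N w c s : ℝ} {f : FPFInv V → ℝ}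

lemma sum_sq_sub_starFit (hN : (Fintype.card V : ℝ) = N + 1) (hN2 : 2 < N)
    (hw : (Fintype.card (FPFInv V) : ℝ) = N * w) (hw0 : w ≠ 0) (hf : ∀ π, f π = 0 ∨ f π = 1)
    (hc : ∑ π, f π = c * w) :
    ∑ π, (f π - starFit N w c f π) ^ 2 =
      w * (c - c * (c / N) - (N - 2) / (N - 1) * energy w (c / N) f) := by
  have hN0 : N ≠ 0 := by linarith
  have hN1 : N - 1 ≠ 0 := by linarith
  set Y := weight (centered w (c / N) f) with hY
  have hY1 : ∑ π, Y π = 0 := by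
    rw [hY, sum_weight hN hN0 hw fun _ => centered_of_isDiag, sum_centered hN hN0 hw0 hc, mul_zero]
  have hY2 : ∑ π, Y π ^ 2 = w * ((N - 1) / (N - 2)) * energy w (c / N) f :=
    sum_sq_weight hN hN2 hw (fun _ => centered_of_isDiag) (sum_centered_mk hN hN0 hw0 hc)
  have hfY : ∑ π, f π * Y π = w * energy w (c / N) f := sum_mul_weight_centered hN hN0 hw0 hc
  have hexpand : ∀ π, (f π - starFit N w c f π) ^ 2 =
      f π - 2 * (c / N) * f π - 2 * ((N - 2) / (N - 1)) * (f π * Y π) + (c / N) ^ 2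
        + 2 * (c / N) * ((N - 2) / (N - 1)) * Y π + ((N - 2) / (N - 1)) ^ 2 * Y π ^ 2 := by
    intro π
    have hsq : f π ^ 2 = f π := by rcases hf π with h | h <;> simp [h]
    rw [starFit, ← hY]
    linear_combination hsq
  simp only [hexpand, Finset.sum_add_distrib, Finset.sum_sub_distrib, ← Finset.mul_sum, hc, hfY,
    hY1, hY2, Finset.sum_const, Finset.card_univ, nsmul_eq_mul, hw]
  field_simp
  ring

lemma le_energy (hN : (Fintype.card V : ℝ) = N + 1) (hN2 : 2 < N)
    (hw : (Fintype.card (FPFInv V) : ℝ) = N * w) (hw0 : 0 < w) (hf : ∀ π, f π = 0 ∨ f π = 1)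
    (hc : ∑ π, f π = c * w) (hD : ∑ π, (f π - starFit N w c f π) ^ 2 ≤ s ^ 2 * (c * w)) :
    c - c * (c / N) - s ^ 2 * c ≤ energy w (c / N) f := by
  rw [sum_sq_sub_starFit hN hN2 hw hw0.ne' hf hc, mul_comm c w, mul_left_comm] at hD
  have hbound := le_of_mul_le_mul_left hD hw0
  have hratio : (N - 2) / (N - 1) ≤ 1 := by rw [div_le_one (by linarith)]; linarith
  have := mul_le_of_le_one_left (energy_nonneg (w := w) (t := c / N) (f := f)) hratio
  linarith

lemma energy_le (hN : (Fintype.card V : ℝ) = N + 1) (hN4 : 4 ≤ N)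
    (hw : (Fintype.card (FPFInv V) : ℝ) = N * w) (hw0 : 0 < w) (hf : ∀ π, f π = 0 ∨ f π = 1)
    (hc : ∑ π, f π = c * w) (hc0 : 0 ≤ c) : energy w (c / N) f ≤ c * (1 + 2 / N) := by
  have hDnonneg : 0 ≤ ∑ π, (f π - starFit N w c f π) ^ 2 := Finset.sum_nonneg fun _ _ => sq_nonneg _
  rw [sum_sq_sub_starFit hN (by linarith) hw hw0.ne' hf hc] at hDnonneg
  have hbound := nonneg_of_mul_nonneg_right hDnonneg hw0
  have hratio : 1 ≤ (N - 2) / (N - 1) * (1 + 2 / N) := by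
    rw [div_mul_eq_mul_div, le_div_iff₀ (by linarith), one_mul]
    have : (N - 2) * (1 + 2 / N) = N - 4 / N := by field_simp; ring
    have : 4 / N ≤ 1 := by rwa [div_le_one (by linarith)]
    linarith
  have hcN : 0 ≤ c * (c / N) := by positivity
  have hpos : 0 < (N - 2) / (N - 1) := div_pos (by linarith) (by linarith)
  refine le_of_mul_le_mul_left ?_ hpos
  calc (N - 2) / (N - 1) * energy w (c / N) f ≤ c := by linarith
    _ ≤ c * ((N - 2) / (N - 1) * (1 + 2 / N)) := le_mul_of_one_le_right hc0 hratio
    _ = (N - 2) / (N - 1) * (c * (1 + 2 / N)) := by ring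

end Energy

end FPFInv

lemma three_mul_sub_two_le_posPart_cube (y : ℝ) : 3 * y - 2 ≤ max y 0 ^ 3 := by
  rcases le_total y 0 with h | h
  · rw [max_eq_right h]
    linarith
  · rw [max_eq_left h]
    nlinarith [sq_nonneg (y - 1)]

lemma sum_mul_le_of_sum_sq_le {ι : Type*} {s : Finset ι} {x y : ι → ℝ} {A B M : ℝ}
    (hx : ∑ i ∈ s, x i ^ 2 ≤ A) (hy : ∑ i ∈ s, y i ^ 2 ≤ B) (hAB : A * B ≤ M ^ 2) (hM : 0 ≤ M) :
    ∑ i ∈ s, x i * y i ≤ M := by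
  have hx0 : 0 ≤ ∑ i ∈ s, x i ^ 2 := Finset.sum_nonneg fun _ _ => sq_nonneg _
  have hy0 : 0 ≤ ∑ i ∈ s, y i ^ 2 := Finset.sum_nonneg fun _ _ => sq_nonneg _
  refine le_of_sq_le_sq ?_ hM
  calc (∑ i ∈ s, x i * y i) ^ 2 ≤ (∑ i ∈ s, x i ^ 2) * ∑ i ∈ s, y i ^ 2 :=
        Finset.sum_mul_sq_le_sq_mul_sq s x y
    _ ≤ A * B := mul_le_mul hx hy hy0 (hx0.trans hx)
    _ ≤ M ^ 2 := hAB

lemma sq_mul_sub_le_of_mul_le {N w c s S R A B G : ℝ} (hN : 2 ≤ N) (hw : 0 < w) (hc : 0 ≤ c)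
    (hs : 0 ≤ s) (hS : 0 ≤ S) (hSc : S ≤ 2 * c)
    (hAB : (N - 2) * A ≤ (N - 1) * B + 2 * S * G) (hA : w * (3 * S - 2 * c) ≤ A)
    (hB : (N - 2) / (N - 1) * B ≤ w * R + 2 * s * c * w)
    (hG : (N - 2) / (N - 1) * G ≤ c * w + s * N * w) :
    ((N - 2) / (N - 1)) ^ 2 * (3 * S - 2 * c) ≤ R + 2 * s * c + 8 * c * (c / N + s) := by
  have hN1 : 0 < N - 1 := by linarith
  set r := (N - 2) / (N - 1) with hr
  have hr0 : 0 ≤ r := div_nonneg (by linarith) hN1.le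
  have hrA : r * A ≤ B + 2 * S / (N - 1) * G := by
    rw [hr, div_mul_eq_mul_div, div_le_iff₀ hN1]
    refine hAB.trans_eq ?_
    field_simp
  have hcoeff : 2 * S * (N / (N - 1)) ≤ 8 * c := by
    have hdiv : N / (N - 1) ≤ 2 := by rw [div_le_iff₀ hN1]; linarith
    calc 2 * S * (N / (N - 1)) ≤ 2 * S * 2 := mul_le_mul_of_nonneg_left hdiv (by linarith)
      _ ≤ 8 * c := by linarith
  refine le_of_mul_le_mul_left ?_ hw
  calc w * (r ^ 2 * (3 * S - 2 * c)) = r * (r * (w * (3 * S - 2 * c))) := by ring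
    _ ≤ r * (B + 2 * S / (N - 1) * G) :=
        mul_le_mul_of_nonneg_left ((mul_le_mul_of_nonneg_left hA hr0).trans hrA) hr0
    _ = r * B + 2 * S / (N - 1) * (r * G) := by ring
    _ ≤ w * R + 2 * s * c * w + 2 * S / (N - 1) * (c * w + s * N * w) :=
        add_le_add hB (mul_le_mul_of_nonneg_left hG (div_nonneg (by linarith) hN1.le))
    _ = w * (R + 2 * s * c + 2 * S * (N / (N - 1)) * (c / N + s)) := by
        have : N ≠ 0 := by linarith
        field_simp
    _ ≤ w * (R + 2 * s * c + 8 * c * (c / N + s)) := by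
        have : 0 ≤ c / N + s := add_nonneg (div_nonneg hc (by linarith)) hs
        gcongr

namespace FPFInv

variable {V : Type*} [Fintype V] [DecidableEq V] {N w c s : ℝ} {f : FPFInv V → ℝ}

lemma mul_energy_le_sum_posPart_cube (hN : (Fintype.card V : ℝ) = N + 1) (hN0 : N ≠ 0)
    (hw0 : w ≠ 0) (hf : ∀ π, f π = 0 ∨ f π = 1) (hc : ∑ π, f π = c * w) :
    w * (3 * energy w (c / N) f - 2 * c) ≤ ∑ π, max (weight (centered w (c / N) f) π) 0 ^ 3 := by
  have hsum : w * (3 * energy w (c / N) f - 2 * c) =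
      ∑ π, f π * (3 * weight (centered w (c / N) f) π - 2) := by
    simp only [mul_sub, Finset.sum_sub_distrib, ← Finset.sum_mul, mul_left_comm _ (3 : ℝ),
      ← Finset.mul_sum, sum_mul_weight_centered hN hN0 hw0 hc, hc]
    ring
  rw [hsum]
  refine Finset.sum_le_sum fun π _ => ?_
  have hcube : 0 ≤ max (weight (centered w (c / N) f) π) 0 ^ 3 := by positivity
  rcases hf π with h | h <;> rw [h]
  · rwa [zero_mul]
  · rw [one_mul]
    exact three_mul_sub_two_le_posPart_cube _

lemma energy_le_two_mul (hN : (Fintype.card V : ℝ) = N + 1) (hN4 : 4 ≤ N)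
    (hw : (Fintype.card (FPFInv V) : ℝ) = N * w) (hw0 : 0 < w) (hf : ∀ π, f π = 0 ∨ f π = 1)
    (hc : ∑ π, f π = c * w) (hc0 : 0 ≤ c) : energy w (c / N) f ≤ 2 * c := by
  have hsmall : 2 / N ≤ 1 := by rw [div_le_one (by linarith)]; linarith
  calc energy w (c / N) f ≤ c * (1 + 2 / N) := energy_le hN hN4 hw hw0 hf hc hc0
    _ ≤ c * 2 := mul_le_mul_of_nonneg_left (by linarith) hc0
    _ = 2 * c := mul_comm c 2

lemma sum_sq_weight_centered_sq_le (hN : (Fintype.card V : ℝ) = N + 1) (hN4 : 4 ≤ N)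
    (hw : (Fintype.card (FPFInv V) : ℝ) = N * w) (hw0 : 0 < w) (hf : ∀ π, f π = 0 ∨ f π = 1)
    (hc : ∑ π, f π = c * w) (hc0 : 0 ≤ c) (hcN : 2 * c ≤ N - 2) :
    ∑ π, weight (fun e => centered w (c / N) f e ^ 2) π ^ 2 ≤ 4 * c * w := by
  have henergy := energy_le_two_mul hN hN4 hw hw0 hf hc hc0
  have hf0 : ∀ π, 0 ≤ f π := fun π => by rcases hf π with h | h <;> simp [h]
  have hf1 : ∀ π, f π ≤ 1 := fun π => by rcases hf π with h | h <;> simp [h]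
  have hfourth : ∑ e, (centered w (c / N) f e ^ 2) ^ 2 ≤ 2 * c := by
    refine le_trans (Finset.sum_le_sum fun e _ => ?_) henergy
    refine pow_le_of_le_one (sq_nonneg _) ?_ two_ne_zero
    refine centered_sq_le_one hN (by linarith) hw hw0 hf0 hf1 (div_nonneg hc0 (by linarith)) ?_ e
    rw [div_le_one (by linarith)]
    linarith
  have hsquare : w / (N - 2) * energy w (c / N) f ^ 2 ≤ w * (2 * c) := by
    rw [div_mul_eq_mul_div, mul_div_assoc]
    refine mul_le_mul_of_nonneg_left ?_ hw0.le
    rw [div_le_iff₀ (by linarith)]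
    calc energy w (c / N) f ^ 2 ≤ (2 * c) ^ 2 := pow_le_pow_left₀ energy_nonneg henergy 2
      _ = 2 * c * (2 * c) := sq _
      _ ≤ 2 * c * (N - 2) := mul_le_mul_of_nonneg_left hcN (by linarith)
  calc _ ≤ w * ∑ e, (centered w (c / N) f e ^ 2) ^ 2 + w / (N - 2) * energy w (c / N) f ^ 2 :=
        sum_sq_weight_le hN (by linarith) hw hw0.le fun e => sq_nonneg _
    _ ≤ w * (2 * c) + w * (2 * c) :=
        add_le_add (mul_le_mul_of_nonneg_left hfourth hw0.le) hsquare
    _ = 4 * c * w := by ring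

lemma mul_posPart_weight_centered_le (hN0 : 0 ≤ N) (hc0 : 0 ≤ c) (hf : ∀ π, 0 ≤ f π)
    (π : FPFInv V) :
    (N - 2) / (N - 1) * max (weight (centered w (c / N) f) π) 0 ≤
      f π + |f π - starFit N w c f π| := by
  rcases le_total (weight (centered w (c / N) f) π) 0 with hneg | hpos
  · rw [max_eq_right hneg, mul_zero]
    exact add_nonneg (hf π) (abs_nonneg _)
  · have habs := neg_abs_le (f π - starFit N w c f π)
    have hcN : 0 ≤ c / N := div_nonneg hc0 hN0
    rw [max_eq_left hpos]
    unfold starFit at habs ⊢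
    linarith

lemma mul_sum_posPart_weight_le (hN1 : 1 ≤ N) (hw : (Fintype.card (FPFInv V) : ℝ) = N * w)
    (hw0 : 0 ≤ w) (hf : ∀ π, 0 ≤ f π) (hc : ∑ π, f π = c * w) (hc0 : 0 ≤ c) (hcN : c ≤ N)
    (hs0 : 0 ≤ s) (hD : ∑ π, (f π - starFit N w c f π) ^ 2 ≤ s ^ 2 * (c * w)) :
    (N - 2) / (N - 1) * ∑ π, max (weight (centered w (c / N) f) π) 0 ≤ c * w + s * N * w := by
  have hcauchy : ∑ π, |f π - starFit N w c f π| * 1 ≤ s * N * w := by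
    refine sum_mul_le_of_sum_sq_le (A := s ^ 2 * (c * w)) (B := N * w) (by simpa only [sq_abs])
      (by simp [hw]) ?_ (by positivity)
    calc s ^ 2 * (c * w) * (N * w) ≤ s ^ 2 * (N * w) * (N * w) := by gcongr
      _ = (s * N * w) ^ 2 := by ring
  calc _ ≤ ∑ π, (f π + |f π - starFit N w c f π| * 1) := by
        rw [Finset.mul_sum]
        refine Finset.sum_le_sum fun π _ => ?_
        rw [mul_one]
        exact mul_posPart_weight_centered_le (by linarith) hc0 hf π
    _ ≤ c * w + s * N * w := by
        rw [Finset.sum_add_distrib, hc]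
        exact add_le_add_right hcauchy _

lemma mul_sum_posPart_weight_mul_le (hN : (Fintype.card V : ℝ) = N + 1) (hN4 : 4 ≤ N)
    (hw : (Fintype.card (FPFInv V) : ℝ) = N * w) (hw0 : 0 < w) (hf : ∀ π, f π = 0 ∨ f π = 1)
    (hc : ∑ π, f π = c * w) (hc0 : 0 ≤ c) (hcN : 2 * c ≤ N - 2) (hs0 : 0 ≤ s)
    (hD : ∑ π, (f π - starFit N w c f π) ^ 2 ≤ s ^ 2 * (c * w)) :
    (N - 2) / (N - 1) * ∑ π, max (weight (centered w (c / N) f) π) 0 *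
        weight (fun e => centered w (c / N) f e ^ 2) π ≤
      w * ∑ e, centered w (c / N) f e ^ 2 * density w f e + 2 * s * c * w := by
  set Z := weight fun e => centered w (c / N) f e ^ 2
  have hf0 : ∀ π, 0 ≤ f π := fun π => by rcases hf π with h | h <;> simp [h]
  have hcauchy : ∑ π, |f π - starFit N w c f π| * Z π ≤ 2 * s * c * w :=
    sum_mul_le_of_sum_sq_le (by simpa only [sq_abs] using hD)
      (sum_sq_weight_centered_sq_le hN hN4 hw hw0 hf hc hc0 hcN) (le_of_eq (by ring))
      (by positivity)
  calc _ ≤ ∑ π, (f π * Z π + |f π - starFit N w c f π| * Z π) := by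
        rw [Finset.mul_sum]
        refine Finset.sum_le_sum fun π _ => ?_
        rw [← mul_assoc, ← add_mul]
        exact mul_le_mul_of_nonneg_right
          (mul_posPart_weight_centered_le (by linarith) hc0 hf0 π)
          (weight_nonneg (fun e => sq_nonneg _) π)
    _ ≤ _ := by
        rw [Finset.sum_add_distrib, sum_mul_weight_eq_density hw0.ne']
        exact add_le_add_right hcauchy _

lemma sq_mul_energy_sub_le (hN : (Fintype.card V : ℝ) = N + 1) (hN4 : 4 ≤ N)
    (hw : (Fintype.card (FPFInv V) : ℝ) = N * w) (hw0 : 0 < w) (hf : ∀ π, f π = 0 ∨ f π = 1)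
    (hc : ∑ π, f π = c * w) (hc0 : 0 ≤ c) (hcN : 2 * c ≤ N - 2) (hs0 : 0 ≤ s)
    (hD : ∑ π, (f π - starFit N w c f π) ^ 2 ≤ s ^ 2 * (c * w)) :
    ((N - 2) / (N - 1)) ^ 2 * (3 * energy w (c / N) f - 2 * c) ≤
      ∑ e, centered w (c / N) f e ^ 2 * density w f e + 2 * s * c + 8 * c * (c / N + s) := by
  have hf0 : ∀ π, 0 ≤ f π := fun π => by rcases hf π with h | h <;> simp [h]
  have hstein := sum_posPart_cube_weight_le hN (fun _ => centered_of_isDiag)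
    (sum_centered_mk hN (by linarith) hw0.ne' hc)
  have hcube := mul_energy_le_sum_posPart_cube hN (by linarith) hw0.ne' hf hc
  have hB := mul_sum_posPart_weight_mul_le hN hN4 hw hw0 hf hc hc0 hcN hs0 hD
  have hG := mul_sum_posPart_weight_le (by linarith) hw hw0.le hf0 hc hc0 (by linarith) hs0 hD
  rw [← energy] at hstein
  exact sq_mul_sub_le_of_mul_le (by linarith) hw0 hc0 hs0 energy_nonneg
    (energy_le_two_mul hN hN4 hw hw0 hf hc hc0) hstein hcube hB hG

lemma one_sub_le_sq_ratio (hN : 2 ≤ N) : 1 - 4 / N ≤ ((N - 2) / (N - 1)) ^ 2 := by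
  have hratio : 1 - 2 / N ≤ (N - 2) / (N - 1) := by
    rw [one_sub_div (by linarith)]
    exact div_le_div_of_nonneg_left (by linarith) (by linarith) (by linarith)
  have hsmall : 2 / N ≤ 1 := by rwa [div_le_one (by linarith)]
  calc 1 - 4 / N = (1 - 2 / N) ^ 2 - (2 / N) ^ 2 := by ring
    _ ≤ (1 - 2 / N) ^ 2 := sub_le_self _ (sq_nonneg _)
    _ ≤ ((N - 2) / (N - 1)) ^ 2 := pow_le_pow_left₀ (by linarith) hratio 2

theorem sum_centered_sq_mul_one_sub_density_le (hN : (Fintype.card V : ℝ) = N + 1)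
    (hN4 : 4 ≤ N) (hw : (Fintype.card (FPFInv V) : ℝ) = N * w) (hw0 : 0 < w)
    (hf : ∀ π, f π = 0 ∨ f π = 1) (hc : ∑ π, f π = c * w) (hc0 : 0 ≤ c) (hcN : 4 * c ≤ N)
    (hs0 : 0 ≤ s) (hs1 : s ≤ 1 / 12)
    (hD : ∑ π, (f π - starFit N w c f π) ^ 2 ≤ s ^ 2 * (c * w)) :
    ∑ e, centered w (c / N) f e ^ 2 * (1 - density w f e) ≤ 13 * c * (1 / N + c / N + s) := by
  set t := c / N with ht
  have ht0 : 0 ≤ t := div_nonneg hc0 (by linarith)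
  have ht1 : t ≤ 1 / 4 := by rw [ht, div_le_iff₀ (by linarith)]; linarith
  have hs2 : s ^ 2 ≤ s := by rw [sq]; exact mul_le_of_le_one_left hs0 (by linarith)
  have hlower := le_energy hN (by linarith) hw hw0 hf hc hD
  have hupper := energy_le hN hN4 hw hw0 hf hc hc0
  have hmain := sq_mul_energy_sub_le hN hN4 hw hw0 hf hc hc0 (by linarith) hs0 hD
  rw [← ht] at hlower hupper hmain
  have hfactor : c * (1 - 3 * t - 3 * s) ≤ 3 * energy w t f - 2 * c := by
    linarith [mul_le_mul_of_nonneg_left hs2 hc0]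
  have hproduct : (1 - 4 / N) * (c * (1 - 3 * t - 3 * s)) ≤
      ((N - 2) / (N - 1)) ^ 2 * (3 * energy w t f - 2 * c) :=
    mul_le_mul (one_sub_le_sq_ratio (by linarith)) hfactor
      (mul_nonneg hc0 (by linarith)) (sq_nonneg _)
  have hsplit : ∑ e, centered w t f e ^ 2 * (1 - density w f e) =
      energy w t f - ∑ e, centered w t f e ^ 2 * density w f e := by
    simp only [mul_sub, mul_one, Finset.sum_sub_distrib, energy]
  have hcross : 0 ≤ c * (1 / N) * (t + s) :=
    mul_nonneg (mul_nonneg hc0 (one_div_nonneg.2 (by linarith))) (by linarith)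
  have hcN0 : 0 ≤ c * (1 / N) := mul_nonneg hc0 (one_div_nonneg.2 (by linarith))
  rw [show 4 / N = 4 * (1 / N) by ring] at hproduct
  rw [show 2 / N = 2 * (1 / N) by ring] at hupper
  rw [hsplit]
  linarith [mul_nonneg hc0 ht0]

lemma starFit_eq_weight (hN : (Fintype.card V : ℝ) = N + 1) (hN1 : N + 1 ≠ 0) :
    starFit N w c f =
      weight fun e => 2 / (N + 1) * (c / N) + (N - 2) / (N - 1) * centered w (c / N) f e := by
  ext π
  have hconst : (π.edges.card : ℝ) = (N + 1) / 2 := by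
    have h := two_mul_weight (fun _ => 1) π
    simp only [weight, Finset.sum_const, Finset.card_univ, nsmul_eq_mul, mul_one, hN] at h
    linarith
  rw [starFit, weight, weight, Finset.sum_add_distrib, Finset.sum_const, nsmul_eq_mul,
    hconst, ← Finset.mul_sum]
  congr 1
  field_simp

lemma sum_ind_mul_sub_starFit (hN : (Fintype.card V : ℝ) = N + 1) (hN2 : 2 < N)
    (hw : (Fintype.card (FPFInv V) : ℝ) = N * w) (hw0 : w ≠ 0) (hc : ∑ π, f π = c * w)
    {e : Sym2 V} (he : ¬e.IsDiag) : ∑ π, ind e π * (f π - starFit N w c f π) = 0 := by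
  have hN0 : N ≠ 0 := by linarith
  have hN1 : N - 1 ≠ 0 := by linarith
  have hN2' : N - 2 ≠ 0 := by linarith
  have hexpand : ∀ π, ind e π * (f π - starFit N w c f π) = ind e π * f π - c / N * ind e π
      - (N - 2) / (N - 1) * (ind e π * weight (centered w (c / N) f) π) := fun π => by
    rw [starFit]
    ring
  have hdensity : ∑ π, ind e π * f π = density w f e * w := by rw [density, div_mul_cancel₀ _ hw0]
  simp only [hexpand, Finset.sum_sub_distrib, ← Finset.mul_sum, hdensity, sum_ind hN hN0 hw he,
    sum_ind_mul_weight hN hN2 hw (fun _ => centered_of_isDiag) (sum_centered_mk hN hN0 hw0 hc) he,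
    centered_of_not_isDiag he]
  field_simp
  ring

end FPFInv

/-- Perfect matchings of the complete graph as fixed-point-free involutions of the vertices. -/
noncomputable def pmEquiv (n : ℕ) : PerfMatching n ≃ FPFInv (Fin (2 * n)) where
  toFun M :=
    have hM := SimpleGraph.Subgraph.isPerfectMatching_iff.1 M.2
    have hinv : Function.Involutive fun v => (hM v).choose := fun v =>
      ((hM _).choose_spec.2 v (hM v).choose_spec.1.symm).symm
    ⟨hinv.toPerm, hinv, fun v => (hM v).choose_spec.1.ne.symm⟩
  invFun π :=
    ⟨{ verts := Set.univ
       Adj := fun a b => π.1 a = b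
       adj_sub := fun {a b} h => by
         rw [SimpleGraph.top_adj]; rintro rfl; exact π.2.2 a h
       edge_vert := fun _ => Set.mem_univ _
       symm := ⟨fun a b h => π.apply_eq_iff.1 h⟩ },
      SimpleGraph.Subgraph.isPerfectMatching_iff.2 fun v =>
        ⟨π.1 v, rfl, fun _ h => Eq.symm (a := π.1 v) h⟩⟩
  left_inv M := by
    have hM := SimpleGraph.Subgraph.isPerfectMatching_iff.1 M.2
    refine Subtype.ext (SimpleGraph.Subgraph.ext ?_ ?_)
    · exact (SimpleGraph.Subgraph.isSpanning_iff.1 M.2.2).symm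
    · ext a b
      exact ⟨fun h => h ▸ (hM a).choose_spec.1, fun h => ((hM a).choose_spec.2 b h).symm⟩
  right_inv π := by
    refine Subtype.ext (Equiv.ext fun v => ?_)
    have hM : ∀ v, ∃! w, π.1 v = w := fun v => ⟨π.1 v, rfl, fun _ h => h.symm⟩
    exact (hM v).choose_spec.1.symm

lemma mem_edges_pmEquiv {n : ℕ} {M : PerfMatching n} {e : Sym2 (Fin (2 * n))} :
    e ∈ (pmEquiv n M).edges ↔ e ∈ M.1.edgeSet := by
  induction e with | h a b => ?_
  have hM := SimpleGraph.Subgraph.isPerfectMatching_iff.1 M.2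
  rw [FPFInv.mk_mem_edges, SimpleGraph.Subgraph.mem_edgeSet]
  exact ⟨fun h => h ▸ (hM a).choose_spec.1, fun h => ((hM a).choose_spec.2 b h).symm⟩

lemma doubleFactorial_two_mul_sub_one {n : ℕ} (hn : 1 ≤ n) :
    (2 * n - 1)‼ = (2 * n - 1) * (2 * n - 3)‼ := by
  obtain ⟨m, rfl⟩ := Nat.exists_eq_add_of_le' hn
  exact Nat.doubleFactorial_add_one (2 * m)

section Stars

variable {n : ℕ}

lemma card_fin_two_mul : (Fintype.card (Fin (2 * n)) : ℝ) = 2 * (n : ℝ) - 1 + 1 := by simp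

lemma card_fpfInv_fin (hn : 1 ≤ n) :
    (Fintype.card (FPFInv (Fin (2 * n))) : ℝ) = (2 * (n : ℝ) - 1) * ((2 * n - 3)‼ : ℕ) := by
  rw [FPFInv.card_eq_doubleFactorial (Fintype.card_fin _), doubleFactorial_two_mul_sub_one hn,
    Nat.cast_mul, Nat.cast_sub (by omega), Nat.cast_mul, Nat.cast_ofNat, Nat.cast_one]

lemma card_perfMatching (hn : 1 ≤ n) :
    (Fintype.card (PerfMatching n) : ℝ) = (2 * (n : ℝ) - 1) * ((2 * n - 3)‼ : ℕ) := by
  rw [Fintype.card_congr (pmEquiv n), card_fpfInv_fin hn]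

lemma sum_kEdge {F : Sym2 (Fin (2 * n)) → ℝ} (hd : ∀ e, e.IsDiag → F e = 0) :
    ∑ e : KEdge n, F e = ∑ e, F e := by
  refine Fintype.sum_of_injective _ Subtype.val_injective _ _ (fun e he => hd e ?_) fun _ => rfl
  by_contra hdiag
  exact he ⟨⟨e, by rwa [SimpleGraph.edgeSet_top, Set.mem_compl_iff]⟩, rfl⟩

lemma KEdge.not_isDiag (e : KEdge n) : ¬(e : Sym2 (Fin (2 * n))).IsDiag :=
  SimpleGraph.not_isDiag_of_mem_edgeSet _ e.2

lemma card_kEdge (n : ℕ) : Fintype.card (KEdge n) = n * (2 * n - 1) := by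
  rw [← SimpleGraph.edgeFinset_card, SimpleGraph.card_edgeFinset_top_eq_card_choose_two,
    Fintype.card_fin, Nat.choose_two_right, mul_assoc, Nat.mul_div_cancel_left _ two_pos]

lemma sum_indicator_one {Ω : Type*} [Fintype Ω] (S : Set Ω) :
    ∑ x, S.indicator (1 : Ω → ℝ) x = S.ncard := by
  classical
  simp only [Set.indicator_apply, Pi.one_apply, Finset.sum_boole]
  rw [Set.ncard_eq_toFinset_card', Set.toFinset_card, Fintype.card_subtype]

lemma indicatorVec_eq_zero_or_one (S : Set (PerfMatching n)) (M : PerfMatching n) :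
    indicatorVec S M = 0 ∨ indicatorVec S M = 1 := Set.indicator_eq_zero_or_self S 1 M

lemma indicatorVec_inter (S T : Set (PerfMatching n)) (M : PerfMatching n) :
    indicatorVec (S ∩ T) M = indicatorVec S M * indicatorVec T M :=
  congrFun (Set.inter_indicator_one (M₀ := ℝ)) M

lemma sum_indicatorVec (S : Set (PerfMatching n)) : ∑ M, indicatorVec S M = (S.ncard : ℝ) :=
  sum_indicator_one S

lemma indicatorVec_pmStar (e : KEdge n) (M : PerfMatching n) :
    indicatorVec (pmStar n e) M = FPFInv.ind e (pmEquiv n M) := by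
  classical
  exact if_congr mem_edges_pmEquiv.symm rfl rfl

lemma ncard_pmStar (hn : 1 ≤ n) (e : KEdge n) : (pmStar n e).ncard = (2 * n - 3)‼ := by
  have hn' : (1 : ℝ) ≤ n := by exact_mod_cast hn
  have hsum := FPFInv.sum_ind card_fin_two_mul (by linarith) (card_fpfInv_fin hn) e.not_isDiag
  rw [← Equiv.sum_comp (pmEquiv n)] at hsum
  simp only [← indicatorVec_pmStar, sum_indicatorVec] at hsum
  exact_mod_cast hsum

lemma ncard_pmStar_inter_pmStar_le (hn : 2 ≤ n) {e e' : KEdge n} (h : e ≠ e') :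
    ((pmStar n e ∩ pmStar n e').ncard : ℝ) ≤ ((2 * n - 3)‼ : ℕ) / (2 * (n : ℝ) - 1 - 2) := by
  have hn' : (2 : ℝ) ≤ n := by exact_mod_cast hn
  have hsum := FPFInv.sum_ind_mul_ind_le card_fin_two_mul (by linarith)
    (card_fpfInv_fin (by omega)) (Nat.cast_nonneg _) (Subtype.coe_injective.ne h)
  rw [← Equiv.sum_comp (pmEquiv n)] at hsum
  simpa only [← indicatorVec_pmStar, ← indicatorVec_inter, sum_indicatorVec] using hsum

/-- The fraction of the star centered at `e` that lies in `A`. -/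
noncomputable def starDensity (A : Set (PerfMatching n)) (e : KEdge n) : ℝ :=
  (A ∩ pmStar n e).ncard / ((2 * n - 3)‼ : ℕ)

lemma starDensity_nonneg (A : Set (PerfMatching n)) (e : KEdge n) : 0 ≤ starDensity A e :=
  div_nonneg (Nat.cast_nonneg _) (Nat.cast_nonneg _)

lemma starDensity_le_one (hn : 1 ≤ n) (A : Set (PerfMatching n)) (e : KEdge n) :
    starDensity A e ≤ 1 := by
  refine div_le_one_of_le₀ ?_ (Nat.cast_nonneg _)
  rw [← ncard_pmStar hn e]
  exact_mod_cast Set.ncard_le_ncard Set.inter_subset_right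

lemma starDensity_le {A : Set (PerfMatching n)} {c : ℝ}
    (hc : (A.ncard : ℝ) = c * ((2 * n - 3)‼ : ℕ)) (e : KEdge n) : starDensity A e ≤ c := by
  rw [starDensity, div_le_iff₀ (by exact_mod_cast Nat.doubleFactorial_pos _), ← hc]
  exact_mod_cast Set.ncard_le_ncard Set.inter_subset_left

lemma mul_starDensity (A : Set (PerfMatching n)) (e : KEdge n) :
    ((2 * n - 3)‼ : ℕ) * starDensity A e = (A ∩ pmStar n e).ncard :=
  mul_div_cancel₀ _ (by exact_mod_cast (Nat.doubleFactorial_pos _).ne')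

/-- The indicator function of a family of perfect matchings, as a function of involutions. -/
noncomputable def involutionIndicator (A : Set (PerfMatching n)) (π : FPFInv (Fin (2 * n))) : ℝ :=
  indicatorVec A ((pmEquiv n).symm π)

lemma involutionIndicator_pmEquiv (A : Set (PerfMatching n)) (M : PerfMatching n) :
    involutionIndicator A (pmEquiv n M) = indicatorVec A M := by
  rw [involutionIndicator, Equiv.symm_apply_apply]

lemma involutionIndicator_eq_zero_or_one (A : Set (PerfMatching n)) (π : FPFInv (Fin (2 * n))) :
    involutionIndicator A π = 0 ∨ involutionIndicator A π = 1 :=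
  indicatorVec_eq_zero_or_one A _

lemma sum_involutionIndicator (A : Set (PerfMatching n)) :
    ∑ π, involutionIndicator A π = (A.ncard : ℝ) := by
  rw [← sum_indicatorVec]
  exact Equiv.sum_comp (pmEquiv n).symm fun M => indicatorVec A M

lemma density_involutionIndicator (A : Set (PerfMatching n)) (e : KEdge n) :
    FPFInv.density ((2 * n - 3)‼ : ℕ) (involutionIndicator A) e = starDensity A e := by
  rw [FPFInv.density, starDensity, ← sum_indicatorVec, ← Equiv.sum_comp (pmEquiv n)]
  refine congrArg (· / _) (Finset.sum_congr rfl fun M _ => ?_)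
  rw [indicatorVec_inter, indicatorVec_pmStar, involutionIndicator_pmEquiv, mul_comm]

lemma centered_involutionIndicator (t : ℝ) (A : Set (PerfMatching n)) (e : KEdge n) :
    FPFInv.centered ((2 * n - 3)‼ : ℕ) t (involutionIndicator A) e = starDensity A e - t := by
  rw [FPFInv.centered_of_not_isDiag e.not_isDiag, density_involutionIndicator]

lemma energy_involutionIndicator (t : ℝ) (A : Set (PerfMatching n)) :
    FPFInv.energy ((2 * n - 3)‼ : ℕ) t (involutionIndicator A) =
      ∑ e, (starDensity A e - t) ^ 2 := by
  rw [FPFInv.energy, ← sum_kEdge fun e he => by rw [FPFInv.centered_of_isDiag he, sq, zero_mul]]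
  simp only [centered_involutionIndicator]

lemma sum_centered_involutionIndicator (t : ℝ) (A : Set (PerfMatching n)) :
    ∑ e, FPFInv.centered ((2 * n - 3)‼ : ℕ) t (involutionIndicator A) e ^ 2
        * (1 - FPFInv.density ((2 * n - 3)‼ : ℕ) (involutionIndicator A) e) =
      ∑ e, (starDensity A e - t) ^ 2 * (1 - starDensity A e) := by
  rw [← sum_kEdge fun e he => by rw [FPFInv.centered_of_isDiag he, sq, zero_mul, zero_mul]]
  simp only [centered_involutionIndicator, density_involutionIndicator]

lemma toLp_weight_mem_starSpan {F : Sym2 (Fin (2 * n)) → ℝ} :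
    WithLp.toLp 2 (fun M => FPFInv.weight F (pmEquiv n M)) ∈ starSpan n := by
  have hcomb : WithLp.toLp 2 (fun M => FPFInv.weight F (pmEquiv n M)) =
      ∑ e : KEdge n, F e • indicatorVec (pmStar n e) := by
    ext M
    simp only [WithLp.ofLp_sum, Finset.sum_apply, PiLp.smul_apply, smul_eq_mul,
      indicatorVec_pmStar, FPFInv.weight_eq_sum_ind_mul, mul_comm (F _)]
    refine (sum_kEdge (F := fun e => FPFInv.ind e (pmEquiv n M) * F e) fun e he => ?_).symm
    rw [FPFInv.ind_eq_zero_of_isDiag he, zero_mul]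
  rw [hcomb]
  exact Submodule.sum_mem _ fun e _ => Submodule.smul_mem _ _ (Submodule.subset_span ⟨e, rfl⟩)

lemma toLp_mem_starSpan_orthogonal {g : FPFInv (Fin (2 * n)) → ℝ}
    (hg : ∀ e : Sym2 (Fin (2 * n)), ¬e.IsDiag → ∑ π, FPFInv.ind e π * g π = 0) :
    WithLp.toLp 2 (fun M => g (pmEquiv n M)) ∈ (starSpan n)ᗮ := by
  rw [← Submodule.span_singleton_le_iff_mem, ← Submodule.isOrtho_iff_le, starSpan,
    Submodule.isOrtho_span]
  rintro _ rfl _ ⟨e, rfl⟩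
  rw [← hg e e.not_isDiag, ← Equiv.sum_comp (pmEquiv n), PiLp.inner_apply]
  exact Finset.sum_congr rfl fun M _ => by rw [← indicatorVec_pmStar]; rfl

theorem starProjection_indicatorVec (hn : 2 ≤ n) (A : Set (PerfMatching n)) {c : ℝ}
    (hc : (A.ncard : ℝ) = c * ((2 * n - 3)‼ : ℕ)) :
    (starSpan n).starProjection (indicatorVec A) = WithLp.toLp 2 fun M =>
      FPFInv.starFit (2 * n - 1) ((2 * n - 3)‼ : ℕ) c (involutionIndicator A) (pmEquiv n M) := by
  have hn' : (2 : ℝ) ≤ n := by exact_mod_cast hn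
  have hw0 : ((2 * n - 3)‼ : ℝ) ≠ 0 := by exact_mod_cast (Nat.doubleFactorial_pos _).ne'
  refine Submodule.eq_starProjection_of_mem_orthogonal ?_ ?_
  · rw [FPFInv.starFit_eq_weight card_fin_two_mul (by linarith)]
    exact toLp_weight_mem_starSpan
  · have horth := toLp_mem_starSpan_orthogonal fun e he =>
      FPFInv.sum_ind_mul_sub_starFit card_fin_two_mul (by linarith) (card_fpfInv_fin (by omega))
        hw0 ((sum_involutionIndicator A).trans hc) he
    simp only [involutionIndicator_pmEquiv] at horth
    exact horth

lemma sum_sq_le_of_normalizedNorm_sq_le (hn : 1 ≤ n) {g : EuclideanSpace ℝ (PerfMatching n)}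
    {c ε : ℝ} (h : normalizedNorm g ^ 2 ≤ ε * (c / (2 * (n : ℝ) - 1))) :
    ∑ M, g M ^ 2 ≤ ε * (c * ((2 * n - 3)‼ : ℕ)) := by
  have hn' : (1 : ℝ) ≤ n := by exact_mod_cast hn
  have hw0 : (0 : ℝ) < (2 * n - 3)‼ := by exact_mod_cast Nat.doubleFactorial_pos _
  have hN0 : 0 < 2 * (n : ℝ) - 1 := by linarith
  have hsum : 0 ≤ ∑ M, g M ^ 2 := Finset.sum_nonneg fun _ _ => sq_nonneg _
  rw [normalizedNorm, Real.sq_sqrt (by positivity), card_perfMatching hn,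
    one_div_mul_eq_div, div_le_iff₀ (by positivity)] at h
  exact h.trans_eq (by field_simp)

lemma sum_sq_sub_starFit_le (hn : 2 ≤ n) {A : Set (PerfMatching n)} {c s : ℝ}
    (hc : (A.ncard : ℝ) = c * ((2 * n - 3)‼ : ℕ))
    (hA : normalizedNorm (indicatorVec A - (starSpan n).starProjection (indicatorVec A)) ^ 2
      ≤ s ^ 2 * (c / (2 * (n : ℝ) - 1))) :
    ∑ π, (involutionIndicator A π
        - FPFInv.starFit (2 * n - 1) ((2 * n - 3)‼ : ℕ) c (involutionIndicator A) π) ^ 2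
      ≤ s ^ 2 * (c * ((2 * n - 3)‼ : ℕ)) := by
  refine (sum_sq_le_of_normalizedNorm_sq_le (by omega) hA).trans_eq' ?_
  rw [← Equiv.sum_comp (pmEquiv n), starProjection_indicatorVec hn A hc]
  simp only [involutionIndicator_pmEquiv, PiLp.sub_apply]

end Stars

section Heavy

variable {ι : Type*} [Fintype ι] {p : ι → ℝ} {t c N s : ℝ}

/-- The indices at which a function `p`, thought of as taking values near `0` or `1`, is at
least `1 / 2`. The stars of the approximating union are centered at the heavy edges. -/
noncomputable def heavy (p : ι → ℝ) : Finset ι := {e | 1 / 2 ≤ p e}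

lemma mem_heavy {e : ι} : e ∈ heavy p ↔ 1 / 2 ≤ p e := by
  simp only [heavy, Finset.mem_filter, Finset.mem_univ, true_and]

lemma sixteenth_le_sq_of_mem_heavy (ht : t ≤ 1 / 4) {e : ι} (he : e ∈ heavy p) :
    1 / 16 ≤ (p e - t) ^ 2 := by
  have hgap : 1 / 4 ≤ p e - t := by linarith [mem_heavy.1 he]
  linarith [pow_le_pow_left₀ (by norm_num) hgap 2]

lemma card_heavy_le (ht : t ≤ 1 / 4) : ((heavy p).card : ℝ) ≤ 16 * ∑ e, (p e - t) ^ 2 := by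
  calc ((heavy p).card : ℝ) = 16 * ∑ e ∈ heavy p, (1 / 16 : ℝ) := by
        rw [Finset.sum_const, nsmul_eq_mul]; ring
    _ ≤ 16 * ∑ e ∈ heavy p, (p e - t) ^ 2 := by
        gcongr with e he
        exact sixteenth_le_sq_of_mem_heavy ht he
    _ ≤ 16 * ∑ e, (p e - t) ^ 2 :=
        mul_le_mul_of_nonneg_left (Finset.sum_le_univ_sum_of_nonneg fun _ => sq_nonneg _)
          (by norm_num)

lemma sum_heavy_one_sub_le (ht : t ≤ 1 / 4) (hp1 : ∀ e, p e ≤ 1) :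
    ∑ e ∈ heavy p, (1 - p e) ≤ 16 * ∑ e, (p e - t) ^ 2 * (1 - p e) := by
  rw [Finset.mul_sum]
  refine (Finset.sum_le_sum fun e he => ?_).trans
    (Finset.sum_le_univ_sum_of_nonneg fun e => ?_)
  · linarith [mul_le_mul_of_nonneg_right (sixteenth_le_sq_of_mem_heavy ht he)
      (sub_nonneg.2 (hp1 e))]
  · exact mul_nonneg (by norm_num) (mul_nonneg (sq_nonneg _) (sub_nonneg.2 (hp1 e)))

lemma sum_sq_sub_le_card_heavy (hp0 : ∀ e, 0 ≤ p e) (hp1 : ∀ e, p e ≤ 1) (ht0 : 0 ≤ t)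
    (ht1 : t ≤ 1) :
    ∑ e, (p e - t) ^ 2 - 2 * ∑ e, (p e - t) ^ 2 * (1 - p e) ≤ (heavy p).card := by
  classical
  have hcard : ((heavy p).card : ℝ) = ∑ e, if e ∈ heavy p then (1 : ℝ) else 0 := by
    rw [Finset.sum_boole, Finset.filter_univ_mem]
  rw [hcard, Finset.mul_sum, ← Finset.sum_sub_distrib]
  refine Finset.sum_le_sum fun e _ => ?_
  have hsq0 : 0 ≤ (p e - t) ^ 2 := sq_nonneg _
  split_ifs with he
  · have hsq1 : (p e - t) ^ 2 ≤ 1 := by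
      rw [sq_le_one_iff_abs_le_one, abs_le]
      constructor <;> linarith [hp0 e, hp1 e]
    linarith [mul_nonneg hsq0 (sub_nonneg.2 (hp1 e))]
  · rw [mem_heavy, not_le] at he
    linarith [mul_le_mul_of_nonneg_left he.le hsq0]

lemma card_heavy_le_add (ht : t ≤ 1 / 4) (hp1 : ∀ e, p e ≤ 1) :
    ((heavy p).card : ℝ) ≤ ∑ e, (p e - t) ^ 2
      + 32 * ∑ e, (p e - t) ^ 2 * (1 - p e) + 2 * ((heavy p).card * t) := by
  have hone : ∑ _ ∈ heavy p, (1 : ℝ) ≤ ∑ e ∈ heavy p, ((p e - t) ^ 2 + 2 * (1 - p e) + 2 * t) :=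
    Finset.sum_le_sum fun e _ => by linarith [sq_nonneg (p e - t - 1)]
  simp only [Finset.sum_add_distrib, Finset.sum_const, nsmul_eq_mul, mul_one,
    ← Finset.mul_sum] at hone
  have hsq : ∑ e ∈ heavy p, (p e - t) ^ 2 ≤ ∑ e, (p e - t) ^ 2 :=
    Finset.sum_le_univ_sum_of_nonneg fun _ => sq_nonneg _
  linarith [sum_heavy_one_sub_le ht hp1]

lemma one_sub_mul_sum_sq_le (hpc : ∀ e, p e ≤ c) :
    (1 - c) * ∑ e, (p e - t) ^ 2 ≤ ∑ e, (p e - t) ^ 2 * (1 - p e) := by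
  rw [Finset.mul_sum]
  refine Finset.sum_le_sum fun e _ => ?_
  rw [mul_comm]
  exact mul_le_mul_of_nonneg_left (sub_le_sub_left (hpc e) 1) (sq_nonneg _)

lemma half_le_of_sum_sq_mul_one_sub_le (hc0 : 0 < c) (hs0 : 0 ≤ s) (hs1 : s ≤ 1 / 1000)
    (hN : 1 / N ≤ 1 / 1000) (hcN : c / N ≤ 1 / 1000) (hpc : ∀ e, p e ≤ c)
    (herr : ∑ e, (p e - c / N) ^ 2 * (1 - p e) ≤ 13 * c * (1 / N + c / N + s))
    (hlow : c - c * (c / N) - s ^ 2 * c ≤ ∑ e, (p e - c / N) ^ 2) :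
    1 / 2 ≤ c := by
  by_contra! hlt
  have hs2 : s ^ 2 ≤ 1 / 1000 := (pow_le_of_le_one hs0 (by linarith) two_ne_zero).trans hs1
  have hsum0 : 0 ≤ ∑ e, (p e - c / N) ^ 2 := Finset.sum_nonneg fun _ _ => sq_nonneg _
  have hhalf : 1 / 2 * ∑ e, (p e - c / N) ^ 2 ≤ (1 - c) * ∑ e, (p e - c / N) ^ 2 :=
    mul_le_mul_of_nonneg_right (by linarith) hsum0
  linarith [one_sub_mul_sum_sq_le (t := c / N) hpc, mul_le_mul_of_nonneg_left hs2 hc0.le,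
    mul_le_mul_of_nonneg_left hs1 hc0.le, mul_le_mul_of_nonneg_left hN hc0.le,
    mul_le_mul_of_nonneg_left hcN hc0.le]

lemma mul_add_div_add_le (hN0 : 0 ≤ 1 / N) (hs0 : 0 ≤ s) (hc : 1 / 2 ≤ c) :
    c * (1 / N + c / N + s) ≤ 3 * (c ^ 2 * (s + 1 / N)) := by
  have hcc : c ≤ 2 * c ^ 2 := by
    linarith [mul_le_mul_of_nonneg_left hc (by linarith : 0 ≤ c)]
  calc c * (1 / N + c / N + s) = c * (s + 1 / N) + c ^ 2 * (1 / N) := by ring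
    _ ≤ 2 * c ^ 2 * (s + 1 / N) + c ^ 2 * (s + 1 / N) := by
        gcongr
        exact le_add_of_nonneg_left hs0
    _ = 3 * (c ^ 2 * (s + 1 / N)) := by ring

lemma card_heavy_le_mul (hc0 : 0 ≤ c) (hN : 1 / N ≤ 1 / 2) (hcN : c / N ≤ 1 / 4)
    (hup : ∑ e, (p e - c / N) ^ 2 ≤ c * (1 + 2 / N)) :
    ((heavy p).card : ℝ) ≤ 32 * c := by
  have htwo : c * (1 + 2 / N) ≤ c * 2 :=
    mul_le_mul_of_nonneg_left (by linarith [div_eq_mul_one_div 2 N]) hc0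
  linarith [card_heavy_le (p := p) hcN]

lemma abs_card_heavy_sub_le (hN0 : 0 ≤ 1 / N) (hN : 1 / N ≤ 1 / 2) (hs0 : 0 ≤ s) (hs1 : s ≤ 1)
    (hc : 1 / 2 ≤ c) (hcN : c / N ≤ 1 / 4) (hp0 : ∀ e, 0 ≤ p e) (hp1 : ∀ e, p e ≤ 1)
    (herr : ∑ e, (p e - c / N) ^ 2 * (1 - p e) ≤ 13 * c * (1 / N + c / N + s))
    (hlow : c - c * (c / N) - s ^ 2 * c ≤ ∑ e, (p e - c / N) ^ 2)
    (hup : ∑ e, (p e - c / N) ^ 2 ≤ c * (1 + 2 / N)) :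
    |((heavy p).card : ℝ) - c| ≤ 1500 * (c ^ 2 * (s + 1 / N)) := by
  have hc0 : 0 ≤ c := by linarith
  have ht0 : 0 ≤ c / N := by rw [div_eq_mul_one_div]; exact mul_nonneg hc0 hN0
  have hcombined := mul_add_div_add_le hN0 hs0 hc
  have hct0 : 0 ≤ c * (c / N) := mul_nonneg hc0 ht0
  have hcν0 : 0 ≤ c * (1 / N) := mul_nonneg hc0 hN0
  have hcs0 : 0 ≤ c * s := mul_nonneg hc0 hs0
  have hs2 : c * s ^ 2 ≤ c * s :=
    mul_le_mul_of_nonneg_left (pow_le_of_le_one hs0 hs1 two_ne_zero) hc0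
  have hcardt : (heavy p).card * (c / N) ≤ 32 * c * (c / N) :=
    mul_le_mul_of_nonneg_right (card_heavy_le_mul hc0 hN hcN hup) ht0
  rw [abs_le]
  constructor
  · linarith [sum_sq_sub_le_card_heavy hp0 hp1 ht0 (by linarith)]
  · have hsplit : c * (1 + 2 / N) = c + 2 * (c * (1 / N)) := by ring
    linarith [card_heavy_le_add hcN hp1]

end Heavy

section SymmDiff

variable {Ω ι : Type*}

lemma ncard_symmDiff_le_add [Finite Ω] (A B C : Set Ω) :
    (A ∆ C).ncard ≤ (A ∆ B).ncard + (B ∆ C).ncard :=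
  (Set.ncard_le_ncard (symmDiff_triangle A B C)).trans (Set.ncard_union_le _ _)

lemma indicator_symmDiff_biUnion_le_sq (A : Set Ω) (S : ι → Set Ω) (Z : Finset ι) (x : Ω) :
    (A ∆ ⋃ e ∈ Z, S e).indicator (1 : Ω → ℝ) x
      ≤ (A.indicator 1 x - ∑ e ∈ Z, (S e).indicator 1 x) ^ 2 := by
  have hnonneg : ∀ e ∈ Z, 0 ≤ (S e).indicator (1 : Ω → ℝ) x := fun e _ =>
    Set.indicator_nonneg (fun _ _ => zero_le_one) x
  by_cases hx : x ∈ A ∆ ⋃ e ∈ Z, S e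
  · rw [Set.indicator_of_mem hx, Pi.one_apply]
    rcases hx with ⟨hA, hB⟩ | ⟨hB, hA⟩
    · have hzero : ∑ e ∈ Z, (S e).indicator (1 : Ω → ℝ) x = 0 := Finset.sum_eq_zero fun e he =>
        Set.indicator_of_notMem (fun h => hB (Set.mem_biUnion he h)) _
      rw [hzero, Set.indicator_of_mem hA, Pi.one_apply, sub_zero, one_pow]
    · obtain ⟨e, he, hxe⟩ := Set.mem_iUnion₂.1 hB
      have hone : 1 ≤ ∑ e ∈ Z, (S e).indicator (1 : Ω → ℝ) x := by
        simpa only [Set.indicator_of_mem hxe, Pi.one_apply] using Finset.single_le_sum hnonneg he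
      rw [Set.indicator_of_notMem hA, zero_sub, neg_sq]
      exact one_le_pow₀ hone
  · rw [Set.indicator_of_notMem hx]
    exact sq_nonneg _

lemma ncard_symmDiff_biUnion_le [Finite Ω] (A : Set Ω) (S : ι → Set Ω) (Z : Finset ι) :
    ((A ∆ ⋃ e ∈ Z, S e).ncard : ℝ) ≤ A.ncard - 2 * ∑ e ∈ Z, ((A ∩ S e).ncard : ℝ)
      + ∑ e ∈ Z, ∑ e' ∈ Z, ((S e ∩ S e').ncard : ℝ) := by
  have := Fintype.ofFinite Ω
  have hmul : ∀ (T U : Set Ω) (x : Ω),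
      (T ∩ U).indicator (1 : Ω → ℝ) x = T.indicator 1 x * U.indicator 1 x := fun T U =>
    congrFun Set.inter_indicator_one
  simp only [← sum_indicator_one, Finset.mul_sum]
  rw [Finset.sum_comm (s := Z)]
  simp_rw [Finset.sum_comm (s := Z) (t := Finset.univ)]
  rw [← Finset.sum_sub_distrib, ← Finset.sum_add_distrib]
  refine Finset.sum_le_sum fun x _ => (indicator_symmDiff_biUnion_le_sq A S Z x).trans_eq ?_
  simp only [hmul, ← Finset.mul_sum, ← Finset.sum_mul]
  have hsq : A.indicator (1 : Ω → ℝ) x * A.indicator 1 x = A.indicator 1 x := by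
    rw [← hmul, Set.inter_self]
  linear_combination hsq

lemma ncard_symmDiff_biUnion_le_of_ncard_inter_le [Finite Ω] (A : Set Ω) {S : ι → Set Ω}
    {Z : Finset ι} {w v : ℝ} (hv : 0 ≤ v) (hS : ∀ e ∈ Z, ((S e).ncard : ℝ) ≤ w)
    (hSS : ∀ e ∈ Z, ∀ e' ∈ Z, e ≠ e' → ((S e ∩ S e').ncard : ℝ) ≤ v) :
    ((A ∆ ⋃ e ∈ Z, S e).ncard : ℝ) ≤ A.ncard - 2 * ∑ e ∈ Z, ((A ∩ S e).ncard : ℝ)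
      + (Z.card * w + Z.card ^ 2 * v) := by
  classical
  refine (ncard_symmDiff_biUnion_le A S Z).trans (add_le_add_right ?_ _)
  have hterm : ∀ e ∈ Z, ∀ e' ∈ Z,
      ((S e ∩ S e').ncard : ℝ) ≤ (if e = e' then w else 0) + v := by
    intro e he e' he'
    split_ifs with h
    · rw [← h, Set.inter_self]
      exact (hS e he).trans (le_add_of_nonneg_right hv)
    · rw [zero_add]
      exact hSS e he e' he' h
  calc ∑ e ∈ Z, ∑ e' ∈ Z, ((S e ∩ S e').ncard : ℝ)
      ≤ ∑ e ∈ Z, ∑ e' ∈ Z, ((if e = e' then w else 0) + v) :=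
        Finset.sum_le_sum fun e he => Finset.sum_le_sum fun e' he' => hterm e he e' he'
    _ = Z.card * w + Z.card ^ 2 * v := by
        simp only [Finset.sum_add_distrib, Finset.sum_ite_eq, Finset.sum_ite_mem, Finset.inter_self,
          Finset.sum_const, nsmul_eq_mul]
        ring

lemma ncard_biUnion_le_mul {S : ι → Set Ω} {w : ℕ} (Z : Finset ι)
    (hS : ∀ e ∈ Z, (S e).ncard ≤ w) : (⋃ e ∈ Z, S e).ncard ≤ Z.card * w :=
  (Finset.set_ncard_biUnion_le Z S).trans (Finset.sum_le_card_nsmul Z _ w hS)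

lemma ncard_biUnion_symmDiff_biUnion_le [Finite Ω] {S : ι → Set Ω} {w : ℕ} {Z Z' : Finset ι}
    (hS : ∀ e, (S e).ncard ≤ w) (h : Z ⊆ Z') :
    ((⋃ e ∈ Z, S e) ∆ ⋃ e ∈ Z', S e).ncard ≤ (Z'.card - Z.card) * w := by
  classical
  have hunion : ⋃ e ∈ Z, S e ⊆ ⋃ e ∈ Z', S e :=
    Set.biUnion_mono (Finset.coe_subset.2 h) fun _ _ => subset_rfl
  rw [← Finset.card_sdiff_of_subset h, symmDiff_of_le hunion]
  refine (Set.ncard_le_ncard ?_).trans (ncard_biUnion_le_mul _ fun e _ => hS e)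
  rintro x ⟨hx', hx⟩
  obtain ⟨e, he, hxe⟩ := Set.mem_iUnion₂.1 hx'
  exact Set.mem_biUnion (Finset.mem_sdiff.2 ⟨he, fun hZ => hx (Set.mem_biUnion hZ hxe)⟩) hxe

lemma exists_card_eq_ncard_biUnion_symmDiff_le [Finite Ω] [Fintype ι] {S : ι → Set Ω}
    {w : ℕ} (hS : ∀ e, (S e).ncard ≤ w) (Z : Finset ι) {r : ℕ} (hr : r ≤ Fintype.card ι) :
    ∃ Z' : Finset ι, Z'.card = r ∧
      (((⋃ e ∈ Z, S e) ∆ ⋃ e ∈ Z', S e).ncard : ℝ) ≤ |(Z.card : ℝ) - r| * w := by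
  rcases le_total Z.card r with h | h
  · obtain ⟨Z', hZ, -, rfl⟩ := Finset.exists_subsuperset_card_eq (Finset.subset_univ Z) h hr
    refine ⟨Z', rfl, ?_⟩
    rw [abs_sub_comm, abs_of_nonneg (sub_nonneg.2 (Nat.cast_le.2 h)), ← Nat.cast_sub h]
    exact_mod_cast ncard_biUnion_symmDiff_biUnion_le hS hZ
  · obtain ⟨Z', hZ, rfl⟩ := Finset.exists_subset_card_eq h
    refine ⟨Z', rfl, ?_⟩
    rw [abs_of_nonneg (sub_nonneg.2 (Nat.cast_le.2 h)), ← Nat.cast_sub h, symmDiff_comm]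
    exact_mod_cast ncard_biUnion_symmDiff_biUnion_le hS hZ

end SymmDiff

section NearStarSpan

variable {n : ℕ} {A : Set (PerfMatching n)} {c s : ℝ}

lemma starDensity_estimates (hn : 501 ≤ n) (hc : (A.ncard : ℝ) = c * ((2 * n - 3)‼ : ℕ))
    (hc0 : 0 ≤ c) (hcN : c / (2 * (n : ℝ) - 1) ≤ 1 / 1000) (hs0 : 0 ≤ s) (hs1 : s ≤ 1 / 1000)
    (hA : normalizedNorm (indicatorVec A - (starSpan n).starProjection (indicatorVec A)) ^ 2
      ≤ s ^ 2 * (c / (2 * (n : ℝ) - 1))) :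
    ∑ e, (starDensity A e - c / (2 * (n : ℝ) - 1)) ^ 2 * (1 - starDensity A e)
        ≤ 13 * c * (1 / (2 * (n : ℝ) - 1) + c / (2 * (n : ℝ) - 1) + s) ∧
      c - c * (c / (2 * (n : ℝ) - 1)) - s ^ 2 * c
        ≤ ∑ e, (starDensity A e - c / (2 * (n : ℝ) - 1)) ^ 2 ∧
      ∑ e, (starDensity A e - c / (2 * (n : ℝ) - 1)) ^ 2 ≤ c * (1 + 2 / (2 * (n : ℝ) - 1)) := by
  have hN : (1001 : ℝ) ≤ 2 * n - 1 := by
    have : (501 : ℝ) ≤ n := by exact_mod_cast hn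
    linarith
  have hw0 : (0 : ℝ) < (2 * n - 3)‼ := by exact_mod_cast Nat.doubleFactorial_pos _
  have hcard := card_fpfInv_fin (show 1 ≤ n by omega)
  have hf := involutionIndicator_eq_zero_or_one A
  have hsum := (sum_involutionIndicator A).trans hc
  have hfit := sum_sq_sub_starFit_le (by omega) hc hA
  have hcN4 : 4 * c ≤ 2 * n - 1 := by
    rw [div_le_iff₀ (by linarith)] at hcN
    linarith
  rw [← sum_centered_involutionIndicator, ← energy_involutionIndicator]
  exact ⟨FPFInv.sum_centered_sq_mul_one_sub_density_le card_fin_two_mul (by linarith) hcard hw0 hf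
      hsum hc0 hcN4 hs0 (by linarith) hfit,
    FPFInv.le_energy card_fin_two_mul (by linarith) hcard hw0 hf hsum hfit,
    FPFInv.energy_le card_fin_two_mul (by linarith) hcard hw0 hf hsum hc0⟩

lemma heavy_starDensity_estimates (hn : 501 ≤ n)
    (hc : (A.ncard : ℝ) = c * ((2 * n - 3)‼ : ℕ)) (hc0 : 0 < c)
    (hcN : c / (2 * (n : ℝ) - 1) ≤ 1 / 1000) (hs0 : 0 ≤ s) (hs1 : s ≤ 1 / 1000)
    (hA : normalizedNorm (indicatorVec A - (starSpan n).starProjection (indicatorVec A)) ^ 2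
      ≤ s ^ 2 * (c / (2 * (n : ℝ) - 1))) :
    |((heavy (starDensity A)).card : ℝ) - c| ≤ 1500 * (c ^ 2 * (s + 1 / (2 * (n : ℝ) - 1))) ∧
      ∑ e ∈ heavy (starDensity A), (1 - starDensity A e)
        ≤ 624 * (c ^ 2 * (s + 1 / (2 * (n : ℝ) - 1))) ∧
      ((heavy (starDensity A)).card : ℝ) ≤ 32 * c := by
  have hN : (1000 : ℝ) ≤ 2 * n - 1 := by
    have : (501 : ℝ) ≤ n := by exact_mod_cast hn
    linarith
  have hν : 1 / (2 * (n : ℝ) - 1) ≤ 1 / 1000 := one_div_le_one_div_of_le (by norm_num) hN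
  have hν0 : 0 ≤ 1 / (2 * (n : ℝ) - 1) := one_div_nonneg.2 (by linarith)
  have hp1 := starDensity_le_one (show 1 ≤ n by omega) A
  obtain ⟨herr, hlow, hup⟩ := starDensity_estimates hn hc hc0.le hcN hs0 hs1 hA
  have hhalf := half_le_of_sum_sq_mul_one_sub_le hc0 hs0 hs1 hν hcN (starDensity_le hc) herr hlow
  refine ⟨abs_card_heavy_sub_le hν0 (by linarith) hs0 (by linarith) hhalf (by linarith)
    (starDensity_nonneg A) hp1 herr hlow hup, ?_,
    card_heavy_le_mul hc0.le (by linarith) (by linarith) hup⟩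
  linarith [sum_heavy_one_sub_le (show c / (2 * (n : ℝ) - 1) ≤ 1 / 4 by linarith) hp1,
    mul_add_div_add_le hν0 hs0 hhalf]

lemma ncard_symmDiff_biUnion_pmStar_le (hn : 2 ≤ n)
    (hc : (A.ncard : ℝ) = c * ((2 * n - 3)‼ : ℕ)) (Z : Finset (KEdge n)) :
    ((A ∆ ⋃ e ∈ Z, pmStar n e).ncard : ℝ) ≤ ((2 * n - 3)‼ : ℕ) * (c - Z.card
      + 2 * ∑ e ∈ Z, (1 - starDensity A e) + Z.card ^ 2 / (2 * (n : ℝ) - 1 - 2)) := by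
  have hn' : (2 : ℝ) ≤ n := by exact_mod_cast hn
  refine (ncard_symmDiff_biUnion_le_of_ncard_inter_le A (w := ((2 * n - 3)‼ : ℕ))
    (div_nonneg (Nat.cast_nonneg _) (by linarith)) (fun e _ => ?_) fun e _ e' _ h =>
    ncard_pmStar_inter_pmStar_le hn h).trans_eq ?_
  · rw [ncard_pmStar (by omega)]
  · simp only [← mul_starDensity, ← Finset.mul_sum, hc, Finset.sum_sub_distrib, Finset.sum_const,
      nsmul_eq_mul]
    ring

theorem ncard_symmDiff_biUnion_heavy_le (hn : 501 ≤ n)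
    (hc : (A.ncard : ℝ) = c * ((2 * n - 3)‼ : ℕ)) (hc0 : 0 < c)
    (hcN : c / (2 * (n : ℝ) - 1) ≤ 1 / 1000) (hs0 : 0 ≤ s) (hs1 : s ≤ 1 / 1000)
    (hA : normalizedNorm (indicatorVec A - (starSpan n).starProjection (indicatorVec A)) ^ 2
      ≤ s ^ 2 * (c / (2 * (n : ℝ) - 1))) :
    ((A ∆ ⋃ e ∈ heavy (starDensity A), pmStar n e).ncard : ℝ)
      ≤ ((2 * n - 3)‼ : ℕ) * (5000 * (c ^ 2 * (s + 1 / (2 * (n : ℝ) - 1)))) := by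
  have hN : (1000 : ℝ) ≤ 2 * n - 1 := by
    have : (501 : ℝ) ≤ n := by exact_mod_cast hn
    linarith
  obtain ⟨hcard, hdefect, hcard32⟩ := heavy_starDensity_estimates hn hc hc0 hcN hs0 hs1 hA
  refine (ncard_symmDiff_biUnion_pmStar_le (by omega) hc _).trans
    (mul_le_mul_of_nonneg_left ?_ (Nat.cast_nonneg _))
  have hoverlap : ((heavy (starDensity A)).card : ℝ) ^ 2 / (2 * (n : ℝ) - 1 - 2)
      ≤ 2048 * (c ^ 2 * (s + 1 / (2 * (n : ℝ) - 1))) := by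
    calc ((heavy (starDensity A)).card : ℝ) ^ 2 / (2 * (n : ℝ) - 1 - 2)
        ≤ (32 * c) ^ 2 / ((2 * (n : ℝ) - 1) / 2) := by
          gcongr
          linarith
      _ = 2048 * (c ^ 2 * (1 / (2 * (n : ℝ) - 1))) := by
          rw [div_div_eq_mul_div]
          ring
      _ ≤ 2048 * (c ^ 2 * (s + 1 / (2 * (n : ℝ) - 1))) := by
          gcongr
          exact le_add_of_nonneg_left hs0
  have hX0 : 0 ≤ c ^ 2 * (s + 1 / (2 * (n : ℝ) - 1)) :=
    mul_nonneg (sq_nonneg c) (add_nonneg hs0 (one_div_nonneg.2 (by linarith)))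
  linarith [(abs_le.1 hcard).1]

end NearStarSpan

section Rounding

lemma abs_sub_round_le_self {c : ℝ} (hc : 0 ≤ c) : |c - round c| ≤ c := by
  simpa only [Int.cast_zero, sub_zero, abs_of_nonneg hc] using round_le c 0

variable {n : ℕ} {A : Set (PerfMatching n)} {c : ℝ}

/-- `A` is within `t` stars of a union of `round c` stars, and `c` is within `t` of an integer:
the shape of the conclusion of the stability theorem. The symmetric difference is measured in units
of the size `(2n - 3)‼` of a star. -/
def IsStarApprox (A : Set (PerfMatching n)) (c t : ℝ) : Prop :=
  (∃ Z : Finset (KEdge n), (Z.card : ℤ) = round c ∧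
    ((A ∆ ⋃ e ∈ Z, pmStar n e).ncard : ℝ) ≤ ((2 * n - 3)‼ : ℕ) * t) ∧ |c - round c| ≤ t

lemma IsStarApprox.mono {t u : ℝ} (h : IsStarApprox A c t) (htu : t ≤ u) : IsStarApprox A c u :=
  let ⟨⟨Z, hZ, hdiff⟩, hround⟩ := h
  ⟨⟨Z, hZ, hdiff.trans (mul_le_mul_of_nonneg_left htu (Nat.cast_nonneg _))⟩, hround.trans htu⟩

lemma nonneg_of_ncard_eq_mul (hc : (A.ncard : ℝ) = c * ((2 * n - 3)‼ : ℕ)) : 0 ≤ c :=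
  nonneg_of_mul_nonneg_left (hc ▸ Nat.cast_nonneg _)
    (by exact_mod_cast Nat.doubleFactorial_pos _)

lemma le_of_ncard_eq_mul (hn : 1 ≤ n) (hc : (A.ncard : ℝ) = c * ((2 * n - 3)‼ : ℕ)) :
    c ≤ 2 * n - 1 := by
  have hA : (A.ncard : ℝ) ≤ Fintype.card (PerfMatching n) := by
    rw [← Nat.card_eq_fintype_card, ← Set.ncard_univ]
    exact_mod_cast Set.ncard_le_ncard A.subset_univ
  rw [card_perfMatching hn, hc] at hA
  exact le_of_mul_le_mul_right hA (by exact_mod_cast Nat.doubleFactorial_pos _)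

lemma exists_natCast_eq_round_le_card (hn : 1 ≤ n)
    (hc : (A.ncard : ℝ) = c * ((2 * n - 3)‼ : ℕ)) :
    ∃ r : ℕ, (r : ℤ) = round c ∧ r ≤ Fintype.card (KEdge n) := by
  have hround := (abs_le.1 (abs_sub_round_le_self (nonneg_of_ncard_eq_mul hc))).2
  obtain ⟨r, hr⟩ := Int.eq_ofNat_of_zero_le
    (show 0 ≤ round c by exact_mod_cast (by linarith : (0 : ℝ) ≤ round c))
  refine ⟨r, hr.symm, ?_⟩
  have hlt : (r : ℝ) < 2 * n := by
    have hadd := round_le_add_half c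
    rw [hr, Int.cast_natCast] at hadd
    linarith [le_of_ncard_eq_mul hn hc]
  have hle : r ≤ 2 * n - 1 := Nat.le_sub_one_of_lt (by exact_mod_cast hlt)
  rw [card_kEdge]
  exact hle.trans (Nat.le_mul_of_pos_left _ hn)

lemma isStarApprox_three_mul (hn : 1 ≤ n) (hc : (A.ncard : ℝ) = c * ((2 * n - 3)‼ : ℕ)) :
    IsStarApprox A c (3 * c) := by
  have hc0 := nonneg_of_ncard_eq_mul hc
  refine ⟨?_, (abs_sub_round_le_self hc0).trans (by linarith)⟩
  obtain ⟨r, hr, hrcard⟩ := exists_natCast_eq_round_le_card hn hc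
  obtain ⟨Z, -, rfl⟩ := Finset.exists_subset_card_eq (s := (Finset.univ : Finset (KEdge n))) hrcard
  refine ⟨Z, hr, ?_⟩
  have hsymm : ((A ∆ ⋃ e ∈ Z, pmStar n e).ncard : ℝ)
      ≤ A.ncard + Z.card * ((2 * n - 3)‼ : ℕ) := by
    have hunion := ncard_biUnion_le_mul Z fun e _ => (ncard_pmStar hn e).le
    have htriangle := ncard_symmDiff_le_add A ⊥ (⋃ e ∈ Z, pmStar n e)
    rw [symmDiff_bot, bot_symmDiff] at htriangle
    exact_mod_cast htriangle.trans (Nat.add_le_add_left hunion _)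
  have hcard : (Z.card : ℝ) ≤ 2 * c := by
    have hround := (abs_le.1 (abs_sub_round_le_self hc0)).1
    rw [← hr, Int.cast_natCast] at hround
    linarith
  have hmul := mul_le_mul_of_nonneg_right hcard (Nat.cast_nonneg ((2 * n - 3)‼))
  linarith

lemma exists_card_eq_round_ncard_symmDiff_le_add (hn : 1 ≤ n)
    (hc : (A.ncard : ℝ) = c * ((2 * n - 3)‼ : ℕ)) (Z : Finset (KEdge n)) :
    ∃ Z' : Finset (KEdge n), (Z'.card : ℤ) = round c ∧
      ((A ∆ ⋃ e ∈ Z', pmStar n e).ncard : ℝ) ≤ (A ∆ ⋃ e ∈ Z, pmStar n e).ncard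
        + 2 * |(Z.card : ℝ) - c| * ((2 * n - 3)‼ : ℕ) := by
  obtain ⟨r, hr, hrcard⟩ := exists_natCast_eq_round_le_card hn hc
  obtain ⟨Z', rfl, hZ'⟩ :=
    exists_card_eq_ncard_biUnion_symmDiff_le (fun e => (ncard_pmStar hn e).le) Z hrcard
  refine ⟨Z', hr, ?_⟩
  have htriangle : ((A ∆ ⋃ e ∈ Z', pmStar n e).ncard : ℝ) ≤ (A ∆ ⋃ e ∈ Z, pmStar n e).ncard
      + ((⋃ e ∈ Z, pmStar n e) ∆ ⋃ e ∈ Z', pmStar n e).ncard := by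
    exact_mod_cast ncard_symmDiff_le_add _ _ _
  have hround : |(Z.card : ℝ) - Z'.card| ≤ 2 * |(Z.card : ℝ) - c| := by
    have hnear := round_le c Z.card
    rw [← hr, Int.cast_natCast, Int.cast_natCast, abs_sub_comm c (Z.card : ℝ)] at hnear
    linarith [abs_sub_le (Z.card : ℝ) c Z'.card]
  exact htriangle.trans (add_le_add_right
    (hZ'.trans (mul_le_mul_of_nonneg_right hround (Nat.cast_nonneg _))) _)

end Rounding

section Regimes

variable {n : ℕ} {A : Set (PerfMatching n)} {c s K : ℝ}

lemma exists_forall_doubleFactorial_le (m : ℕ) :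
    ∃ K : ℝ, m ≤ K ∧ ∀ n ≤ m, ((2 * n - 1)‼ : ℝ) ≤ K := by
  refine ⟨((2 * m)! : ℕ), Nat.cast_le.2 ?_, fun n hn => ?_⟩
  · exact (Nat.le_mul_of_pos_left m two_pos).trans (Nat.self_le_factorial _)
  · exact_mod_cast (Nat.doubleFactorial_le_factorial _).trans (Nat.factorial_le (by omega))

lemma one_le_ncard_of_pos (hc : (A.ncard : ℝ) = c * ((2 * n - 3)‼ : ℕ)) (hc0 : 0 < c) :
    (1 : ℝ) ≤ A.ncard := by
  have hpos : (0 : ℝ) < A.ncard :=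
    hc ▸ mul_pos hc0 (by exact_mod_cast Nat.doubleFactorial_pos (2 * n - 3))
  exact_mod_cast hpos

lemma lt_of_mul_div_lt_one {m : ℕ} (hK : ∀ n ≤ m, ((2 * n - 1)‼ : ℝ) ≤ K) (hn : 1 ≤ n)
    (hc : (A.ncard : ℝ) = c * ((2 * n - 3)‼ : ℕ)) (hc0 : 0 < c)
    (hcK : K * (c / (2 * (n : ℝ) - 1)) < 1) : m < n := by
  by_contra! hnm
  have hN : (0 : ℝ) < 2 * n - 1 := by
    have : (1 : ℝ) ≤ n := by exact_mod_cast hn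
    linarith
  have hbound := hK n hnm
  rw [doubleFactorial_two_mul_sub_one hn, Nat.cast_mul, Nat.cast_sub (by omega), Nat.cast_mul,
    Nat.cast_ofNat, Nat.cast_one] at hbound
  refine hcK.not_ge ((one_le_ncard_of_pos hc hc0).trans ?_)
  calc (A.ncard : ℝ) = (2 * (n : ℝ) - 1) * ((2 * n - 3)‼ : ℕ) * (c / (2 * (n : ℝ) - 1)) := by
        rw [hc]
        field_simp
    _ ≤ K * (c / (2 * (n : ℝ) - 1)) := mul_le_mul_of_nonneg_right hbound (by positivity)

theorem isStarApprox_of_sparse (hn : 501 ≤ n)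
    (hc : (A.ncard : ℝ) = c * ((2 * n - 3)‼ : ℕ)) (hc0 : 0 < c)
    (hcN : c / (2 * (n : ℝ) - 1) ≤ 1 / 1000) (hs0 : 0 ≤ s) (hs1 : s ≤ 1 / 1000)
    (hA : normalizedNorm (indicatorVec A - (starSpan n).starProjection (indicatorVec A)) ^ 2
      ≤ s ^ 2 * (c / (2 * (n : ℝ) - 1))) :
    IsStarApprox A c (8000 * (c ^ 2 * (s + 1 / (2 * (n : ℝ) - 1)))) := by
  have hcard := (heavy_starDensity_estimates hn hc hc0 hcN hs0 hs1 hA).1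
  have hheavy := ncard_symmDiff_biUnion_heavy_le hn hc hc0 hcN hs0 hs1 hA
  obtain ⟨Z, hZ, hdiff⟩ :=
    exists_card_eq_round_ncard_symmDiff_le_add (by omega) hc (heavy (starDensity A))
  refine ⟨⟨Z, hZ, ?_⟩, ?_⟩
  · have hmul := mul_le_mul_of_nonneg_right hcard (Nat.cast_nonneg ((2 * n - 3)‼))
    linarith
  · have hround := round_le c (heavy (starDensity A)).card
    rw [Int.cast_natCast, abs_sub_comm c (Finset.card _ : ℝ)] at hround
    linarith [abs_nonneg ((heavy (starDensity A)).card - c)]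

lemma pos_and_mul_div_lt_one_of_lt {N : ℝ} (hK : 0 ≤ K) (hc : 0 ≤ c) (hs : 0 ≤ s) (hN : 0 < N)
    (h : (8000 + 3 * K) * (c ^ 2 * (s + 1 / N)) < 3 * c) : 0 < c ∧ K * (c / N) < 1 := by
  have hc0 : 0 < c := hc.lt_of_ne fun h0 => by simp [← h0] at h
  refine ⟨hc0, ?_⟩
  have hcancel : (8000 + 3 * K) * (c * (s + 1 / N)) < 3 :=
    lt_of_mul_lt_mul_left (by linarith) hc
  have hle : c / N ≤ c * (s + 1 / N) := by
    rw [div_eq_mul_one_div]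
    exact mul_le_mul_of_nonneg_left (le_add_of_nonneg_left hs) hc
  have hKle := mul_le_mul_of_nonneg_left hle hK
  linarith [show 0 ≤ c * (s + 1 / N) by positivity]

theorem isStarApprox_of_near_starSpan (hK1000 : 1000 ≤ K)
    (hK : ∀ n ≤ 1000, ((2 * n - 1)‼ : ℝ) ≤ K) (hn : 1 ≤ n)
    (hc : (A.ncard : ℝ) = c * ((2 * n - 3)‼ : ℕ)) (hs0 : 0 ≤ s) (hs1 : s ≤ 1 / 1000)
    (hA : normalizedNorm (indicatorVec A - (starSpan n).starProjection (indicatorVec A)) ^ 2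
      ≤ s ^ 2 * (c / (2 * (n : ℝ) - 1))) :
    IsStarApprox A c ((8000 + 3 * K) * (c ^ 2 * (s + 1 / (2 * (n : ℝ) - 1)))) := by
  have hN : (0 : ℝ) < 2 * n - 1 := by
    have : (1 : ℝ) ≤ n := by exact_mod_cast hn
    linarith
  have hc0 := nonneg_of_ncard_eq_mul hc
  rcases le_or_gt (3 * c) ((8000 + 3 * K) * (c ^ 2 * (s + 1 / (2 * (n : ℝ) - 1)))) with h | h
  · exact (isStarApprox_three_mul hn hc).mono h
  · obtain ⟨hcpos, hcK⟩ := pos_and_mul_div_lt_one_of_lt (by linarith) hc0 hs0 hN h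
    have hsparse : c / (2 * (n : ℝ) - 1) ≤ 1 / 1000 := by
      have := mul_le_mul_of_nonneg_right hK1000 (div_nonneg hc0 hN.le)
      linarith
    have hn1000 := lt_of_mul_div_lt_one hK hn hc hcpos hcK
    refine (isStarApprox_of_sparse (by omega) hc hcpos hsparse hs0 hs1 hA).mono
      (mul_le_mul_of_nonneg_right (by linarith) ?_)
    exact mul_nonneg (sq_nonneg c) (add_nonneg hs0 (one_div_nonneg.2 hN.le))

end Regimes

theorem mainTheorem3_general :
    ∃ C₀ ε₀ : ℝ, 0 < C₀ ∧ 0 < ε₀ ∧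
      ∀ (n : ℕ), 1 ≤ n → ∀ (A : Set (PerfMatching n)) (c ε : ℝ),
        (A.ncard : ℝ) = c * ((2 * n - 3)‼ : ℕ) →
        0 ≤ ε → ε ≤ ε₀ →
        normalizedNorm (indicatorVec A - (starSpan n).starProjection (indicatorVec A)) ^ 2
            ≤ ε * (c / (2 * (n : ℝ) - 1)) →
        (∃ Z : Finset (KEdge n), (Z.card : ℤ) = round c ∧
          ((A ∆ (⋃ e ∈ Z, pmStar n e)).ncard : ℝ)
            ≤ C₀ * c ^ 2 * ((2 * n - 3)‼ : ℕ) * (Real.sqrt ε + 1 / (2 * (n : ℝ) - 1))) ∧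
        |c - (round c : ℝ)| ≤ C₀ * c ^ 2 * (Real.sqrt ε + 1 / (2 * (n : ℝ) - 1)) := by
  obtain ⟨K, hK1000, hK⟩ := exists_forall_doubleFactorial_le 1000
  rw [Nat.cast_ofNat] at hK1000
  refine ⟨8000 + 3 * K, (1 / 1000) ^ 2, by linarith, by norm_num,
    fun n hn A c ε hc hε0 hε1 hA => ?_⟩
  rw [← Real.sq_sqrt hε0] at hA
  obtain ⟨⟨Z, hZ, hdiff⟩, hround⟩ := isStarApprox_of_near_starSpan hK1000 hK hn hc
    (Real.sqrt_nonneg ε) ((Real.sqrt_le_left (by norm_num)).2 hε1) hA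
  exact ⟨⟨Z, hZ, hdiff.trans_eq (by ring)⟩, hround.trans_eq (by ring)⟩

theorem mainTheorem3 :
    ∃ C₀ ε₀ : ℝ, 0 < C₀ ∧ 0 < ε₀ ∧
      ∀ (n : ℕ), 1 ≤ n → ∀ (A : Set (PerfMatching n)) (c ε : ℝ),
        (A.ncard : ℝ) = c * ((2 * n - 3)‼ : ℕ) →
        c ≤ (2 * (n : ℝ) - 1) / 2 →
        0 ≤ ε → ε ≤ ε₀ →
        normalizedNorm (indicatorVec A - (starSpan n).starProjection (indicatorVec A)) ^ 2
            ≤ ε * (c / (2 * (n : ℝ) - 1)) →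
        (∃ Z : Finset (KEdge n), (Z.card : ℤ) = round c ∧
          ((A ∆ (⋃ e ∈ Z, pmStar n e)).ncard : ℝ)
            ≤ C₀ * c ^ 2 * ((2 * n - 3)‼ : ℕ) * (Real.sqrt ε + 1 / (2 * (n : ℝ) - 1))) ∧
        |c - (round c : ℝ)| ≤ C₀ * c ^ 2 * (Real.sqrt ε + 1 / (2 * (n : ℝ) - 1)) := by
  obtain ⟨C₀, ε₀, hC₀, hε₀, h⟩ := mainTheorem3_general
  exact ⟨C₀, ε₀, hC₀, hε₀, fun n hn A c ε hc _ => h n hn A c ε hc⟩
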